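/- Let $\delta \geq 1$ and $c > 0$ be real numbers. There exist constants $c_1, c_2 > 0$, depending only on $\delta$ and $c$, such that the following holds for every real $x \geq 2$. Let $F, G \subseteq \{1, 2, \ldots, \lfloor x \rfloor\}$ with $\delta < |F| \leq |G|$, suppose that every element of the sumset $F + G = \{f + g : f \in F,\ g \in G\}$ is a prime in the open interval $(\sqrt{x}, 2x)$, and suppose that $|F|\,|G| \geq c\, x/(\log x)^{\delta}$. Then $$ c_1\, \frac{\sqrt{x}}{(\log x)^{\delta+6}} \ \leq\ |F|\ \leq\ |G|\ \leq\ c_2\, \sqrt{x}\,(\log x)^6 . $$ -/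

import Mathlib

open scoped Pointwise

/-!
The hypothesis enters only through one consequence: for a prime `p ≤ √x`, no sum `f + g` is
divisible by `p`, since a sum is a prime exceeding `√x`. So `G` avoids, modulo each such `p`, the
`ν_p` classes `-f` with `f ∈ F`, and sieves bound `|G|` in terms of the sizes `ν_p`.

*The large sieve.* If `𝒮` is a family of sets of primes with `(∏ S)² ≤ x` for `S ∈ 𝒮`, then
`|G| ∑_{S ∈ 𝒮} ∏_{p ∈ S} ν_p / (p - ν_p) ≤ 5x` (`arithmetic_large_sieve`). It is proved in dual
form. Let `h_p` be the function modulo `p` of mean zero which equals `1` off the forbidden classes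
and is constant on them. A suitable combination of the products `∏_{p ∈ S} h_p` is constant on `G`,
and it is a trigonometric polynomial with frequencies at distinct reduced fractions, which are
`1/x`-separated; its mean square is then controlled by `dual_large_sieve`, where the Dirichlet
kernel and a Schur-type estimate do the work.

*Small `F`.* If `F` contains `k` elements, `k` fixed, then `ν_p = k` for these elements except when
`p` divides one of their differences. Using sets of few primes up to `z = x^{1/2J}`, with `J` a
small power of `log x`, and the Euler product up to `z`, one gets `|G| ≤ x / (log x)^{k - ε}`
(`eventually_card_le_div_log_rpow`). As `|F| > δ` and `|F| |G| ≥ c x / (log x)^δ`, this applied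
with `k = ⌊δ⌋ + 1` makes `|F|` unbounded, and applied again with a larger `k` gives
`|F| ≥ (log x)^6` (`eventually_log_pow_six_le_card`).

*Larger `F`.* Gallagher's larger sieve gives `∑_{p ≤ y} (log p) / ν_p ≪ log x` as soon as
`|F| ≥ y / log x`, so `ν_p` is on average at least about `p / log x`. Inserted in the large sieve
with products of `m` primes up to `y`, where `y^{2m} ≤ x`, this yields
`|G| (c y / (log x)²)^m ≤ 5x` (`exists_card_mul_pow_le`). For `(log x)^6 ≤ |F| < x^{1/6}` the choice
`y = |F|`, with `m ≥ 3` maximal, contradicts the lower bound for `|F| |G|`. For `|F| ≥ x^{1/6}` the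
choice `y = ⌊x^{1/6}⌋`, `m = 3` gives `|G| ≪ √x (log x)^6`, which is where the exponent `6` comes
from; the bound for `|F|` follows by division. Bounded `x` are absorbed in the constants.
-/

/-! ### A dual large sieve inequality -/

section LargeSieve

open Finset

/-- The additive character `e(θ) = exp(2πiθ)` of `ℝ / ℤ`, as a complex number. -/
noncomputable def expTwoPi (θ : ℝ) : ℂ := Complex.exp ((2 * Real.pi * θ : ℝ) * Complex.I)

lemma expTwoPi_add (s t : ℝ) : expTwoPi (s + t) = expTwoPi s * expTwoPi t := by
  simp only [expTwoPi, ← Complex.exp_add]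
  congr 1; push_cast; ring

lemma expTwoPi_zero : expTwoPi 0 = 1 := by simp [expTwoPi]

lemma norm_expTwoPi (t : ℝ) : ‖expTwoPi t‖ = 1 := Complex.norm_exp_ofReal_mul_I _

lemma expTwoPi_int (m : ℤ) : expTwoPi m = 1 := by
  rw [expTwoPi, Complex.exp_eq_one_iff]
  exact ⟨m, by push_cast; ring⟩

lemma conj_expTwoPi (t : ℝ) : (starRingEnd ℂ) (expTwoPi t) = expTwoPi (-t) := by
  simp only [expTwoPi, ← Complex.exp_conj, map_mul, Complex.conj_ofReal, Complex.conj_I]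
  congr 1; push_cast; ring

lemma expTwoPi_nat_mul (n : ℕ) (t : ℝ) : expTwoPi (n * t) = expTwoPi t ^ n := by
  simp only [expTwoPi, ← Complex.exp_nat_mul]
  congr 1; push_cast; ring

lemma expTwoPi_sum {ι : Type*} (s : Finset ι) (f : ι → ℝ) :
    expTwoPi (∑ i ∈ s, f i) = ∏ i ∈ s, expTwoPi (f i) := by
  classical
  induction s using Finset.induction_on with
  | empty => simp [expTwoPi_zero]
  | insert a s ha ih => rw [sum_insert ha, prod_insert ha, expTwoPi_add, ih]

lemma four_mul_abs_le_norm_expTwoPi_sub_one (r : ℝ) (hr : |r| ≤ 1 / 2) :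
    4 * |r| ≤ ‖expTwoPi r - 1‖ := by
  have h := Complex.norm_exp_I_mul_ofReal_sub_one (2 * Real.pi * r)
  rw [expTwoPi, mul_comm (_ : ℂ) Complex.I, h, Real.norm_eq_abs, abs_mul, abs_two]
  have h1 : |Real.pi * r| ≤ Real.pi / 2 := by
    rw [abs_mul, abs_of_pos Real.pi_pos]
    nlinarith [Real.pi_pos]
  have h2 := Real.mul_abs_le_abs_sin h1
  rw [abs_mul, abs_of_pos Real.pi_pos, ← mul_assoc, div_mul_cancel₀ _ Real.pi_pos.ne'] at h2
  have h3 : 2 * Real.pi * r / 2 = Real.pi * r := by ring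
  rw [h3]
  linarith

/-- The Dirichlet kernel `∑_{u < K} e(uθ)`. -/
noncomputable def dirichletKernel (K : ℕ) (θ : ℝ) : ℂ := ∑ u ∈ range K, expTwoPi (u * θ)

lemma norm_dirichletKernel_le (K : ℕ) (θ : ℝ) : ‖dirichletKernel K θ‖ ≤ K := by
  refine (norm_sum_le _ _).trans ?_
  simp [norm_expTwoPi]

lemma norm_dirichletKernel_neg (K : ℕ) (θ : ℝ) :
    ‖dirichletKernel K (-θ)‖ = ‖dirichletKernel K θ‖ := by
  rw [← Complex.norm_conj (dirichletKernel K θ)]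
  simp only [dirichletKernel, map_sum, conj_expTwoPi, mul_neg]

lemma norm_dirichletKernel_mul_le (K : ℕ) (θ : ℝ) :
    ‖dirichletKernel K θ‖ * (2 * |θ - round θ|) ≤ 1 := by
  have h1 : expTwoPi θ = expTwoPi (θ - round θ) := by
    conv_lhs => rw [← sub_add_cancel θ (round θ : ℝ)]
    rw [expTwoPi_add, expTwoPi_int, mul_one]
  have h2 := four_mul_abs_le_norm_expTwoPi_sub_one _ (abs_sub_round θ)
  rw [← h1] at h2
  have h3 : dirichletKernel K θ * (expTwoPi θ - 1) = expTwoPi θ ^ K - 1 := by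
    simp only [dirichletKernel, expTwoPi_nat_mul]
    exact geom_sum_mul _ _
  have h4 : ‖dirichletKernel K θ‖ * ‖expTwoPi θ - 1‖ ≤ 2 := by
    rw [← norm_mul, h3]
    refine (norm_sub_le _ _).trans ?_
    rw [norm_pow, norm_expTwoPi]; norm_num
  nlinarith [norm_nonneg (dirichletKernel K θ)]

/-- Reciprocal squares of the members of a `1/N`-separated set on one side of zero. -/
lemma sum_inv_sq_le_of_separated {ι : Type*} (s : Finset ι) (r : ι → ℝ) (N : ℕ) (hN : 0 < N)
    (hr : ∀ i ∈ s, 1 / (N : ℝ) ≤ r i)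
    (hsep : ∀ i ∈ s, ∀ j ∈ s, i ≠ j → 1 / (N : ℝ) ≤ |r i - r j|) :
    ∑ i ∈ s, 1 / r i ^ 2 ≤ 2 * (N : ℝ) ^ 2 := by
  classical
  have hN' : (0 : ℝ) < N := by exact_mod_cast hN
  set φ : ι → ℕ := fun i => ⌊N * r i⌋₊ with hφ
  have hφ1 : ∀ i ∈ s, 1 ≤ φ i := by
    intro i hi
    refine Nat.le_floor ?_
    have := hr i hi
    rw [div_le_iff₀ hN'] at this
    push_cast; linarith
  have hrpos : ∀ i ∈ s, 0 < r i := fun i hi => lt_of_lt_of_le (by positivity) (hr i hi)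
  have hinj : Set.InjOn φ s := by
    intro i hi j hj hij
    by_contra hne
    have h := hsep i hi j hj hne
    have h1 := Nat.floor_le (mul_nonneg hN'.le (hrpos i hi).le)
    have h2 := Nat.floor_le (mul_nonneg hN'.le (hrpos j hj).le)
    have h3 := Nat.lt_floor_add_one (N * r i)
    have h4 := Nat.lt_floor_add_one (N * r j)
    have h5 : (⌊N * r i⌋₊ : ℝ) = (⌊N * r j⌋₊ : ℝ) := by exact_mod_cast hij
    rw [div_le_iff₀ hN'] at h
    rcases abs_cases (r i - r j) with ⟨h6, _⟩ | ⟨h6, _⟩ <;> rw [h6] at h <;> nlinarith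
  have hb : ∀ i ∈ s, 1 / r i ^ 2 ≤ (N : ℝ) ^ 2 * ((φ i : ℝ) ^ 2)⁻¹ := by
    intro i hi
    have h1 : (φ i : ℝ) ≤ N * r i := Nat.floor_le (mul_nonneg hN'.le (hrpos i hi).le)
    have h0 : (1 : ℝ) ≤ φ i := by exact_mod_cast hφ1 i hi
    have h2 : (φ i : ℝ) ^ 2 ≤ N ^ 2 * r i ^ 2 := by
      rw [← mul_pow]; gcongr
    rw [← div_eq_mul_inv, div_le_div_iff₀ (pow_pos (hrpos i hi) 2) (by positivity)]
    linarith
  refine (sum_le_sum hb).trans ?_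
  rw [← mul_sum, mul_comm]
  gcongr
  rw [← sum_image (f := fun k : ℕ => ((k : ℝ) ^ 2)⁻¹) hinj]
  have hsub : s.image φ ⊆ Ioo 0 ((s.image φ).sup id + 1) := by
    intro k hk
    rw [mem_Ioo]
    refine ⟨?_, Nat.lt_succ_of_le (le_sup (f := id) hk)⟩
    obtain ⟨i, hi, rfl⟩ := mem_image.1 hk
    exact hφ1 i hi
  refine (sum_le_sum_of_subset_of_nonneg hsub fun _ _ _ => by positivity).trans ?_
  simpa using sum_Ioo_inv_sq_le (α := ℝ) 0 ((s.image φ).sup id + 1)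

lemma sum_norm_sq_dirichletKernel_le {ι : Type*} (s : Finset ι) (α : ι → ℝ) (N : ℕ) (hN : 0 < N)
    (hsep : ∀ i ∈ s, ∀ j ∈ s, i ≠ j → ∀ m : ℤ, 1 / (N : ℝ) ≤ |α i - α j - m|)
    (i : ι) (hi : i ∈ s) :
    ∑ j ∈ s, ‖dirichletKernel (2 * N) (α i - α j)‖ ^ 2 ≤ 5 * (N : ℝ) ^ 2 := by
  classical
  have hN' : (0 : ℝ) < N := by exact_mod_cast hN
  rw [← add_sum_erase _ _ hi]
  have h0 : ‖dirichletKernel (2 * N) (α i - α i)‖ ^ 2 ≤ 4 * (N : ℝ) ^ 2 := by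
    have := norm_dirichletKernel_le (2 * N) (α i - α i)
    push_cast at this
    nlinarith [norm_nonneg (dirichletKernel (2 * N) (α i - α i))]
  set r : ι → ℝ := fun j => (α i - α j) - round (α i - α j) with hr
  have hrN : ∀ j ∈ s.erase i, 1 / (N : ℝ) ≤ |r j| := fun j hj =>
    hsep i hi j (mem_of_mem_erase hj) (ne_of_mem_erase hj).symm _
  have hrsep : ∀ j ∈ s, ∀ k ∈ s, j ≠ k → 1 / (N : ℝ) ≤ |r j - r k| := by
    intro j hj k hk hjk
    have h := hsep k hk j hj hjk.symm (round (α i - α j) - round (α i - α k))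
    convert h using 2
    simp only [hr]; push_cast; ring
  have hterm : ∀ j ∈ s.erase i,
      ‖dirichletKernel (2 * N) (α i - α j)‖ ^ 2 ≤ (1 / 4) * (1 / r j ^ 2) := by
    intro j hj
    have h1 : 0 < |r j| := lt_of_lt_of_le (by positivity) (hrN j hj)
    have h2 := norm_dirichletKernel_mul_le (2 * N) (α i - α j)
    have h3 : ‖dirichletKernel (2 * N) (α i - α j)‖ ≤ 1 / (2 * |r j|) := by
      rw [le_div_iff₀ (by positivity)]; exact h2
    calc _ ≤ (1 / (2 * |r j|)) ^ 2 := by gcongr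
      _ = _ := by rw [div_pow, mul_pow, sq_abs]; ring_nf
  have hsum : ∑ j ∈ s.erase i, 1 / r j ^ 2 ≤ 4 * (N : ℝ) ^ 2 := by
    rw [← sum_filter_add_sum_filter_not _ (fun j => 0 ≤ r j)]
    have hp := sum_inv_sq_le_of_separated ((s.erase i).filter fun j => 0 ≤ r j) r N hN
      (by
        intro j hj
        have := hrN j (mem_filter.1 hj).1
        rwa [abs_of_nonneg (mem_filter.1 hj).2] at this)
      (fun j hj k hk hjk => hrsep j (mem_of_mem_erase (mem_filter.1 hj).1) k
        (mem_of_mem_erase (mem_filter.1 hk).1) hjk)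
    have hn := sum_inv_sq_le_of_separated ((s.erase i).filter fun j => ¬ 0 ≤ r j)
      (fun j => - r j) N hN
      (by
        intro j hj
        have := hrN j (mem_filter.1 hj).1
        rwa [abs_of_neg (not_le.1 (mem_filter.1 hj).2)] at this)
      (by
        intro j hj k hk hjk
        have := hrsep k (mem_of_mem_erase (mem_filter.1 hk).1) j
          (mem_of_mem_erase (mem_filter.1 hj).1) hjk.symm
        convert this using 2
        ring)
    simp only [neg_sq] at hn
    linarith
  have := sum_le_sum hterm
  rw [← mul_sum] at this
  linarith

/-- The dual large sieve inequality: a trigonometric polynomial with `1/N`-separated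
frequencies modulo one has mean square over `1, …, N` at most five times the sum of the squares
of its coefficients. The sum over `n` is majorised by one over differences `u - v` with
`0 ≤ u, v < 2N`, which turns the off-diagonal terms into values of the squared Dirichlet kernel. -/
theorem dual_large_sieve {ι : Type*} (s : Finset ι) (α : ι → ℝ) (c : ι → ℂ) (N : ℕ) (hN : 0 < N)
    (hsep : ∀ i ∈ s, ∀ j ∈ s, i ≠ j → ∀ m : ℤ, 1 / (N : ℝ) ≤ |α i - α j - m|) :
    ∑ n ∈ Icc 1 N, ‖∑ i ∈ s, c i * expTwoPi (α i * n)‖ ^ 2 ≤ 5 * N * ∑ i ∈ s, ‖c i‖ ^ 2 := by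
  have hN' : (0 : ℝ) < N := by exact_mod_cast hN
  set T : ℝ → ℂ := fun t => ∑ i ∈ s, c i * expTwoPi (α i * t) with hT
  have hcount : (N : ℝ) * ∑ n ∈ Icc 1 N, ‖T n‖ ^ 2 ≤
      ∑ u ∈ range (2 * N), ∑ v ∈ range (2 * N), ‖T ((u : ℝ) - v)‖ ^ 2 := by
    rw [sum_comm]
    have h1 : ∀ v ∈ range N, ∑ n ∈ Icc 1 N, ‖T n‖ ^ 2 ≤
        ∑ u ∈ range (2 * N), ‖T ((u : ℝ) - v)‖ ^ 2 := by
      intro v hv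
      rw [mem_range] at hv
      have h2 : ∑ n ∈ Icc 1 N, ‖T n‖ ^ 2 =
          ∑ u ∈ (Icc 1 N).map (addLeftEmbedding v), ‖T ((u : ℝ) - v)‖ ^ 2 := by
        rw [sum_map]
        refine sum_congr rfl fun n _ => ?_
        simp
      rw [h2]
      refine sum_le_sum_of_subset_of_nonneg ?_ fun _ _ _ => by positivity
      intro u hu
      simp only [mem_map, mem_Icc, addLeftEmbedding_apply] at hu
      obtain ⟨n, hn, rfl⟩ := hu
      rw [mem_range]; omega
    have h3 := sum_le_sum h1
    rw [sum_const, card_range, nsmul_eq_mul] at h3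
    refine h3.trans (sum_le_sum_of_subset_of_nonneg ?_ fun _ _ _ => by positivity)
    exact range_mono (by omega)
  have hexpand : ((∑ u ∈ range (2 * N), ∑ v ∈ range (2 * N), ‖T ((u : ℝ) - v)‖ ^ 2 : ℝ) : ℂ) =
      ∑ i ∈ s, ∑ j ∈ s, c i * (starRingEnd ℂ) (c j) *
        (dirichletKernel (2 * N) (α i - α j) *
          (starRingEnd ℂ) (dirichletKernel (2 * N) (α i - α j))) := by
    push_cast
    have h1 : ∀ u v : ℕ, ((‖T ((u : ℝ) - v)‖ : ℂ)) ^ 2 = ∑ i ∈ s, ∑ j ∈ s,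
        c i * (starRingEnd ℂ) (c j) * (expTwoPi (u * (α i - α j)) *
          (starRingEnd ℂ) (expTwoPi (v * (α i - α j)))) := by
      intro u v
      rw [← Complex.mul_conj']
      simp only [hT, map_sum, sum_mul_sum, map_mul, conj_expTwoPi]
      refine sum_congr rfl fun i _ => sum_congr rfl fun j _ => ?_
      rw [mul_mul_mul_comm, ← expTwoPi_add, ← expTwoPi_add]
      congr 2; ring
    simp only [h1, dirichletKernel, map_sum, sum_mul_sum]
    simp only [mul_sum]
    calc _ = ∑ u ∈ range (2 * N), ∑ i ∈ s, ∑ v ∈ range (2 * N), ∑ j ∈ s,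
          c i * (starRingEnd ℂ) (c j) * (expTwoPi (u * (α i - α j)) *
          (starRingEnd ℂ) (expTwoPi (v * (α i - α j)))) :=
        sum_congr rfl fun u _ => sum_comm
      _ = ∑ i ∈ s, ∑ u ∈ range (2 * N), ∑ v ∈ range (2 * N), ∑ j ∈ s,
          c i * (starRingEnd ℂ) (c j) * (expTwoPi (u * (α i - α j)) *
          (starRingEnd ℂ) (expTwoPi (v * (α i - α j)))) := sum_comm
      _ = ∑ i ∈ s, ∑ u ∈ range (2 * N), ∑ j ∈ s, ∑ v ∈ range (2 * N),
          c i * (starRingEnd ℂ) (c j) * (expTwoPi (u * (α i - α j)) *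
          (starRingEnd ℂ) (expTwoPi (v * (α i - α j)))) :=
        sum_congr rfl fun i _ => sum_congr rfl fun u _ => sum_comm
      _ = _ := sum_congr rfl fun i _ => sum_comm
  have hbound : ∑ u ∈ range (2 * N), ∑ v ∈ range (2 * N), ‖T ((u : ℝ) - v)‖ ^ 2 ≤
      5 * (N : ℝ) ^ 2 * ∑ i ∈ s, ‖c i‖ ^ 2 := by
    set K : ι → ι → ℝ := fun i j => ‖dirichletKernel (2 * N) (α i - α j)‖ ^ 2 with hK
    have hKsymm : ∀ i j, K i j = K j i := by
      intro i j
      simp only [hK]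
      rw [← norm_dirichletKernel_neg, neg_sub]
    have h1 : ∑ u ∈ range (2 * N), ∑ v ∈ range (2 * N), ‖T ((u : ℝ) - v)‖ ^ 2 ≤
        ∑ i ∈ s, ∑ j ∈ s, ‖c i‖ * ‖c j‖ * K i j := by
      have h2 : 0 ≤ ∑ u ∈ range (2 * N), ∑ v ∈ range (2 * N), ‖T ((u : ℝ) - v)‖ ^ 2 := by
        positivity
      rw [← Complex.norm_of_nonneg h2, hexpand]
      refine (norm_sum_le _ _).trans (sum_le_sum fun i _ => (norm_sum_le _ _).trans
        (sum_le_sum fun j _ => ?_))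
      simp only [norm_mul, RCLike.norm_conj, hK]
      rw [← sq]
    have h2 : ∑ i ∈ s, ∑ j ∈ s, ‖c i‖ * ‖c j‖ * K i j ≤
        ∑ i ∈ s, ∑ j ∈ s, (‖c i‖ ^ 2 * K i j / 2 + ‖c j‖ ^ 2 * K j i / 2) := by
      refine sum_le_sum fun i _ => sum_le_sum fun j _ => ?_
      rw [hKsymm j i]
      have : 0 ≤ K i j := by positivity
      nlinarith [mul_nonneg (sq_nonneg (‖c i‖ - ‖c j‖)) this]
    have h3 : ∑ i ∈ s, ∑ j ∈ s, ‖c i‖ ^ 2 * K i j / 2 ≤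
        5 * (N : ℝ) ^ 2 * (∑ i ∈ s, ‖c i‖ ^ 2) / 2 := by
      simp only [← sum_div, ← mul_sum]
      gcongr
      rw [mul_sum]
      refine sum_le_sum fun i hi => ?_
      rw [mul_comm]
      gcongr
      exact sum_norm_sq_dirichletKernel_le s α N hN hsep i hi
    simp only [sum_add_distrib] at h2
    rw [sum_comm (f := fun i j => ‖c j‖ ^ 2 * K j i / 2)] at h2
    linarith
  have h := hcount.trans hbound
  have h' : (N : ℝ) * ∑ n ∈ Icc 1 N, ‖T n‖ ^ 2 ≤ N * (5 * N * ∑ i ∈ s, ‖c i‖ ^ 2) := by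
    refine h.trans (le_of_eq ?_); ring
  exact le_of_mul_le_mul_left h' hN'

end LargeSieve

/-! ### The arithmetic large sieve -/

section ArithmeticSieve

open Finset

lemma sum_expTwoPi_Icc (p : ℕ) (hp : 0 < p) (m : ℤ) :
    ∑ a ∈ Icc 1 (p - 1), expTwoPi (a * (m / p : ℝ)) = if (p : ℤ) ∣ m then (p : ℂ) - 1 else -1 := by
  have hp' : (p : ℝ) ≠ 0 := by positivity
  have h1 : ∑ a ∈ range p, expTwoPi (a * (m / p : ℝ)) =
      1 + ∑ a ∈ Icc 1 (p - 1), expTwoPi (a * (m / p : ℝ)) := by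
    have : range p = insert 0 (Icc 1 (p - 1)) := by
      ext a; simp only [mem_range, mem_insert, mem_Icc]; omega
    rw [this, sum_insert (by simp)]
    simp [expTwoPi_zero]
  have h2 : ∑ a ∈ range p, expTwoPi (a * (m / p : ℝ)) = if (p : ℤ) ∣ m then (p : ℂ) else 0 := by
    split_ifs with hd
    · obtain ⟨k, rfl⟩ := hd
      have : ∀ a ∈ range p, expTwoPi (a * (((p * k : ℤ) : ℝ) / p)) = 1 := by
        intro a _
        rw [← expTwoPi_int (a * k)]
        congr 1; push_cast; field_simp
      rw [sum_congr rfl this]; simp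
    · simp only [expTwoPi_nat_mul]
      have hne : expTwoPi (m / p : ℝ) ≠ 1 := by
        intro h
        rw [expTwoPi, Complex.exp_eq_one_iff] at h
        obtain ⟨k, hk⟩ := h
        apply hd
        refine ⟨k, ?_⟩
        have h3 : ((2 * Real.pi * (m / p) : ℝ) : ℂ) * Complex.I = ((k * (2 * Real.pi) : ℝ) : ℂ) *
            Complex.I := by rw [hk]; push_cast; ring
        have h4 := Complex.ofReal_injective (mul_right_cancel₀ Complex.I_ne_zero h3)
        have h5 : (m : ℝ) = p * k := by
          have h6 : (m : ℝ) / p = k := by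
            have := Real.pi_pos
            nlinarith
          field_simp at h6
          linarith
        exact_mod_cast h5
      have h3 := geom_sum_mul (expTwoPi (m / p : ℝ)) p
      have h4 : expTwoPi (m / p : ℝ) ^ p = 1 := by
        rw [← expTwoPi_nat_mul, mul_div_cancel₀ _ hp', expTwoPi_int]
      rw [h4, sub_self] at h3
      exact (mul_eq_zero.1 h3).resolve_right (sub_ne_zero.2 hne)
  rw [h2] at h1
  split_ifs with hd
  · rw [if_pos hd] at h1; rw [h1]; ring
  · rw [if_neg hd] at h1; linear_combination -h1

/-- The Fourier coefficient at `a / p` of the function modulo `p` which has mean zero and equals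
one at every `n` with `p ∤ n + b` for all `b ∈ B`. -/
noncomputable def sieveCoeff (B : Finset ℕ) (p a : ℕ) : ℂ :=
  -(1 / (B.card : ℂ)) * ∑ b ∈ B, expTwoPi (a * (b / p : ℝ))

lemma sum_sieveCoeff_mul_expTwoPi (B : Finset ℕ) (hB : B.Nonempty) (p : ℕ) (hp : 0 < p) (n : ℕ)
    (hn : ∀ b ∈ B, ¬ p ∣ n + b) :
    ∑ a ∈ Icc 1 (p - 1), sieveCoeff B p a * expTwoPi (a / p * n) = 1 := by
  have hc : (B.card : ℂ) ≠ 0 := by exact_mod_cast hB.card_pos.ne'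
  have h1 : ∀ b ∈ B, ∑ a ∈ Icc 1 (p - 1), expTwoPi (a * (b / p : ℝ)) * expTwoPi (a / p * n) =
      -1 := by
    intro b hb
    have h := sum_expTwoPi_Icc p hp ((n + b : ℕ) : ℤ)
    rw [if_neg (by exact_mod_cast hn b hb)] at h
    rw [← h]
    refine sum_congr rfl fun a _ => ?_
    rw [← expTwoPi_add]
    congr 1; push_cast; ring
  calc _ = -(1 / (B.card : ℂ)) * ∑ b ∈ B, ∑ a ∈ Icc 1 (p - 1),
        expTwoPi (a * (b / p : ℝ)) * expTwoPi (a / p * n) := by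
        rw [sum_comm, mul_sum]
        refine sum_congr rfl fun a _ => ?_
        rw [sieveCoeff, mul_assoc, sum_mul]
    _ = 1 := by
        rw [sum_congr rfl h1, sum_const, nsmul_eq_mul]
        field_simp

lemma sum_norm_sq_sieveCoeff (B : Finset ℕ) (hB : B.Nonempty) (p : ℕ) (hp : 0 < p)
    (hinj : ∀ b ∈ B, ∀ b' ∈ B, (p : ℤ) ∣ b - b' → b = b') :
    ∑ a ∈ Icc 1 (p - 1), ‖sieveCoeff B p a‖ ^ 2 = (p - B.card) / B.card := by
  have hc : (B.card : ℂ) ≠ 0 := by exact_mod_cast hB.card_pos.ne'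
  apply Complex.ofReal_injective
  push_cast
  have h1 : ∀ a : ℕ, (‖sieveCoeff B p a‖ : ℂ) ^ 2 = (1 / (B.card : ℂ)) ^ 2 *
      ∑ b ∈ B, ∑ b' ∈ B, expTwoPi (a * (((b : ℤ) - b' : ℤ) / p : ℝ)) := by
    intro a
    rw [← Complex.mul_conj']
    simp only [sieveCoeff, map_mul, map_neg, map_sum, map_div₀, map_one, map_natCast,
      conj_expTwoPi]
    rw [mul_mul_mul_comm, sum_mul_sum]
    simp only [← expTwoPi_add]
    congr 1
    · ring
    · refine sum_congr rfl fun b _ => sum_congr rfl fun b' _ => ?_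
      congr 1; push_cast; ring
  calc _ = (1 / (B.card : ℂ)) ^ 2 * ∑ b ∈ B, ∑ b' ∈ B, ∑ a ∈ Icc 1 (p - 1),
        expTwoPi (a * (((b : ℤ) - b' : ℤ) / p : ℝ)) := by
        simp only [h1]
        rw [← mul_sum, sum_comm]
        congr 1
        exact sum_congr rfl fun b _ => sum_comm
    _ = (1 / (B.card : ℂ)) ^ 2 * ∑ b ∈ B, ∑ b' ∈ B, ((if b = b' then (p : ℂ) else 0) - 1) := by
        congr 1
        refine sum_congr rfl fun b hb => sum_congr rfl fun b' hb' => ?_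
        rw [sum_expTwoPi_Icc p hp]
        by_cases h : b = b'
        · subst h; simp
        · rw [if_neg h, if_neg fun hd => h (hinj b hb b' hb' hd)]; ring
    _ = _ := by
        simp only [sum_sub_distrib, sum_ite_eq, sum_const, nsmul_eq_mul, mul_one]
        rw [sum_congr rfl fun b hb => if_pos hb]
        simp only [sum_const, nsmul_eq_mul]
        field_simp

/-- The indices `(S, a)` with `S` in the family and `1 ≤ a p < p` for `p ∈ S`; such an index
stands for the reduced fraction `∑_{p ∈ S} a p / p` of denominator `∏ S`. -/
def sieveIndex (𝒮 : Finset (Finset ℕ)) : Finset (Σ S : Finset ℕ, ∀ p ∈ S, ℕ) :=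
  𝒮.sigma fun S => S.pi fun p => Icc 1 (p - 1)

/-- The fraction `∑_{p ∈ S} a p / p` attached to an index `(S, a)`. -/
noncomputable def sieveFreq (i : Σ S : Finset ℕ, ∀ p ∈ S, ℕ) : ℝ :=
  ∑ p ∈ i.1.attach, (i.2 p p.2 : ℝ) / (p : ℕ)

lemma exists_int_prod_mul_sieveFreq (i : Σ S : Finset ℕ, ∀ p ∈ S, ℕ) (hS : ∀ p ∈ i.1, p ≠ 0) :
    ∃ k : ℤ, ((∏ p ∈ i.1, p : ℕ) : ℝ) * sieveFreq i = k := by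
  refine ⟨∑ p ∈ i.1.attach, i.2 p p.2 * ∏ q ∈ i.1.erase p, q, ?_⟩
  rw [sieveFreq, mul_sum]
  push_cast
  refine sum_congr rfl fun p _ => ?_
  rw [← mul_prod_erase _ _ p.2]
  have : ((p : ℕ) : ℝ) ≠ 0 := by exact_mod_cast hS p p.2
  field_simp

/-- The tuple of numerators of an index, extended by zero to all primes. -/
def sieveNumerator (i : Σ S : Finset ℕ, ∀ p ∈ S, ℕ) (p : ℕ) : ℕ :=
  if h : p ∈ i.1 then i.2 p h else 0

lemma sieveFreq_eq_sum (i : Σ S : Finset ℕ, ∀ p ∈ S, ℕ) (P : Finset ℕ) (hP : i.1 ⊆ P) :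
    sieveFreq i = ∑ p ∈ P, (sieveNumerator i p : ℝ) / p := by
  rw [← sum_subset hP, ← sum_attach, sieveFreq]
  · refine sum_congr rfl fun p _ => ?_
    simp [sieveNumerator]
  · intro p _ hp
    simp [sieveNumerator, hp]

/-- Distinct indices give fractions that differ modulo one. -/
lemma sieveFreq_sub_ne_int (𝒮 : Finset (Finset ℕ)) (hprime : ∀ S ∈ 𝒮, ∀ p ∈ S, p.Prime)
    (i j : Σ S : Finset ℕ, ∀ p ∈ S, ℕ) (hi : i ∈ sieveIndex 𝒮) (hj : j ∈ sieveIndex 𝒮)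
    (m : ℤ) (h : sieveFreq i - sieveFreq j = m) : i = j := by
  obtain ⟨S, a⟩ := i
  obtain ⟨S', a'⟩ := j
  simp only [sieveIndex, mem_sigma, mem_pi, mem_Icc] at hi hj
  set i : Σ S : Finset ℕ, ∀ p ∈ S, ℕ := ⟨S, a⟩ with hidef
  set j : Σ S : Finset ℕ, ∀ p ∈ S, ℕ := ⟨S', a'⟩ with hjdef
  set P := S ∪ S' with hP
  have hPprime : ∀ p ∈ P, p.Prime := by
    intro p hp
    rcases mem_union.1 hp with hp | hp
    · exact hprime S hi.1 p hp
    · exact hprime S' hj.1 p hp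
  rw [sieveFreq_eq_sum i P subset_union_left, sieveFreq_eq_sum j P subset_union_right,
    ← sum_sub_distrib] at h
  have hlt : ∀ p ∈ P, sieveNumerator i p < p ∧ sieveNumerator j p < p := by
    intro p hp
    have := (hPprime p hp).two_le
    constructor
    · unfold sieveNumerator
      split_ifs with hm
      · have := hi.2 p hm
        exact lt_of_le_of_lt this.2 (by omega)
      · omega
    · unfold sieveNumerator
      split_ifs with hm
      · have := hj.2 p hm
        exact lt_of_le_of_lt this.2 (by omega)
      · omega
  have heq : ∀ p ∈ P, sieveNumerator i p = sieveNumerator j p := by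
    intro p hp
    set Δ : ℕ → ℤ := fun q => (sieveNumerator i q : ℤ) - sieveNumerator j q with hΔ
    -- clearing denominators leaves `p` dividing `Δ p * ∏_{q ≠ p} q`
    have h1 : ∑ q ∈ P, Δ q * ∏ r ∈ P.erase q, (r : ℤ) = m * ∏ r ∈ P, (r : ℤ) := by
      have h2 : ((∑ q ∈ P, Δ q * ∏ r ∈ P.erase q, (r : ℤ) : ℤ) : ℝ) =
          ((m * ∏ r ∈ P, (r : ℤ) : ℤ) : ℝ) := by
        push_cast
        rw [← h, sum_mul]
        refine sum_congr rfl fun q hq => ?_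
        rw [← mul_prod_erase P (fun r : ℕ => (r : ℝ)) hq]
        have : (q : ℝ) ≠ 0 := by exact_mod_cast (hPprime q hq).ne_zero
        simp only [hΔ]
        push_cast
        field_simp
      exact_mod_cast h2
    have h3 : (p : ℤ) ∣ Δ p * ∏ r ∈ P.erase p, (r : ℤ) := by
      rw [← add_sum_erase _ _ hp] at h1
      have h4 : (p : ℤ) ∣ ∑ q ∈ P.erase p, Δ q * ∏ r ∈ P.erase q, (r : ℤ) := by
        refine dvd_sum fun q hq => Dvd.dvd.mul_left (dvd_prod_of_mem _ ?_) _
        exact mem_erase.2 ⟨(ne_of_mem_erase hq).symm, hp⟩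
      have h5 : (p : ℤ) ∣ m * ∏ r ∈ P, (r : ℤ) :=
        Dvd.dvd.mul_left (dvd_prod_of_mem (fun r : ℕ => (r : ℤ)) hp) _
      rw [← h1] at h5
      exact (dvd_add_left h4).1 h5
    have hpp : Prime (p : ℤ) := Nat.prime_iff_prime_int.1 (hPprime p hp)
    rcases hpp.dvd_or_dvd h3 with h4 | h4
    · have h5 := Int.eq_zero_of_abs_lt_dvd h4 (by
        have := hlt p hp
        simp only [hΔ]
        rw [abs_lt]; omega)
      simp only [hΔ] at h5
      omega
    · obtain ⟨r, hr, hd⟩ := (Prime.dvd_finsetProd_iff hpp _).1 h4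
      have h5 : p ∣ r := by exact_mod_cast hd
      rw [(Nat.prime_dvd_prime_iff_eq (hPprime p hp)
        (hPprime r (mem_of_mem_erase hr))).1 h5] at hr
      exact absurd rfl (ne_of_mem_erase hr)
  have hmem : ∀ p, p ∈ S ↔ p ∈ S' := by
    intro p
    constructor
    · intro hp
      by_contra hn
      have h1 := heq p (mem_union_left _ hp)
      simp only [sieveNumerator, hidef, hjdef, dif_pos hp, dif_neg hn] at h1
      have h2 : 1 ≤ a p hp := (hi.2 p hp).1
      exact Nat.one_le_iff_ne_zero.1 h2 h1
    · intro hp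
      by_contra hn
      have h1 := heq p (mem_union_right _ hp)
      simp only [sieveNumerator, hidef, hjdef, dif_pos hp, dif_neg hn] at h1
      have h2 : 1 ≤ a' p hp := (hj.2 p hp).1
      exact Nat.one_le_iff_ne_zero.1 h2 h1.symm
  have hSS : S = S' := Finset.ext hmem
  subst hSS
  simp only [hidef, hjdef]
  congr 1
  funext p hp
  have h1 := heq p (mem_union_left _ hp)
  simpa only [sieveNumerator, hidef, hjdef, dif_pos hp] using h1

lemma sieveFreq_separated (𝒮 : Finset (Finset ℕ)) (hprime : ∀ S ∈ 𝒮, ∀ p ∈ S, p.Prime) (N : ℕ)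
    (hQ : ∀ S ∈ 𝒮, (∏ p ∈ S, p) ^ 2 ≤ N) :
    ∀ i ∈ sieveIndex 𝒮, ∀ j ∈ sieveIndex 𝒮, i ≠ j → ∀ m : ℤ,
      1 / (N : ℝ) ≤ |sieveFreq i - sieveFreq j - m| := by
  intro i hi j hj hij m
  have hi1 : i.1 ∈ 𝒮 := (mem_sigma.1 hi).1
  have hj1 : j.1 ∈ 𝒮 := (mem_sigma.1 hj).1
  have hne : sieveFreq i - sieveFreq j - m ≠ 0 := fun h =>
    hij (sieveFreq_sub_ne_int 𝒮 hprime i j hi hj m (by linarith))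
  obtain ⟨k, hk⟩ := exists_int_prod_mul_sieveFreq i fun p hp => (hprime _ hi1 p hp).ne_zero
  obtain ⟨l, hl⟩ := exists_int_prod_mul_sieveFreq j fun p hp => (hprime _ hj1 p hp).ne_zero
  set q := ∏ p ∈ i.1, p with hq
  set q' := ∏ p ∈ j.1, p with hq'
  have hq0 : (0 : ℝ) < q := by
    exact_mod_cast prod_pos fun p hp => (hprime _ hi1 p hp).pos
  have hq0' : (0 : ℝ) < q' := by
    exact_mod_cast prod_pos fun p hp => (hprime _ hj1 p hp).pos
  have hqq : (q : ℝ) * q' ≤ N := by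
    have h1 : (q : ℝ) ^ 2 ≤ N := by exact_mod_cast hQ _ hi1
    have h2 : (q' : ℝ) ^ 2 ≤ N := by exact_mod_cast hQ _ hj1
    nlinarith [sq_nonneg ((q : ℝ) - q')]
  have hint : (q : ℝ) * q' * (sieveFreq i - sieveFreq j - m) =
      ((q' * k - q * l - q * q' * m : ℤ) : ℝ) := by
    push_cast
    rw [← hk, ← hl]; ring
  have h1 : 1 ≤ |(q : ℝ) * q' * (sieveFreq i - sieveFreq j - m)| := by
    rw [hint, ← Int.cast_abs]
    have h2 : (q' * k - q * l - q * q' * m : ℤ) ≠ 0 := by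
      intro h0
      rw [h0, Int.cast_zero] at hint
      exact (mul_ne_zero (mul_pos hq0 hq0').ne' hne) hint
    exact_mod_cast Int.one_le_abs h2
  rw [abs_mul, abs_of_pos (mul_pos hq0 hq0')] at h1
  rw [div_le_iff₀ (lt_of_lt_of_le (mul_pos hq0 hq0') hqq)]
  nlinarith [abs_nonneg (sieveFreq i - sieveFreq j - m)]

/-- The arithmetic large sieve. The trigonometric polynomial
`∑_{S ∈ 𝒮} ∏_{p ∈ S} ν_p / (p - ν_p) · h_p(n)`, with `h_p` as in `sieveCoeff`, takes the constant
value `L = ∑_{S ∈ 𝒮} ∏_{p ∈ S} ν_p / (p - ν_p)` on `G`, and its coefficients have square sum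
`L`. -/
theorem arithmetic_large_sieve (𝒮 : Finset (Finset ℕ)) (hprime : ∀ S ∈ 𝒮, ∀ p ∈ S, p.Prime)
    (N : ℕ) (hN : 0 < N) (hQ : ∀ S ∈ 𝒮, (∏ p ∈ S, p) ^ 2 ≤ N) (G : Finset ℕ)
    (hG : G ⊆ Icc 1 N) (B : ℕ → Finset ℕ) (hB : ∀ S ∈ 𝒮, ∀ p ∈ S, (B p).Nonempty)
    (hBp : ∀ S ∈ 𝒮, ∀ p ∈ S, (B p).card < p)
    (hinj : ∀ S ∈ 𝒮, ∀ p ∈ S, ∀ b ∈ B p, ∀ b' ∈ B p, (p : ℤ) ∣ b - b' → b = b')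
    (hGB : ∀ g ∈ G, ∀ S ∈ 𝒮, ∀ p ∈ S, ∀ b ∈ B p, ¬ p ∣ g + b) :
    (G.card : ℝ) * ∑ S ∈ 𝒮, ∏ p ∈ S, ((B p).card : ℝ) / (p - (B p).card) ≤ 5 * N := by
  set w : Finset ℕ → ℝ := fun S => ∏ p ∈ S, ((B p).card : ℝ) / (p - (B p).card) with hw
  set L := ∑ S ∈ 𝒮, w S with hL
  have hwpos : ∀ S ∈ 𝒮, 0 < w S := by
    intro S hS
    refine prod_pos fun p hp => div_pos ?_ ?_
    · exact_mod_cast (hB S hS p hp).card_pos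
    · rw [sub_pos]; exact_mod_cast hBp S hS p hp
  set c : (Σ S : Finset ℕ, ∀ p ∈ S, ℕ) → ℂ := fun i =>
    w i.1 * ∏ p ∈ i.1.attach, sieveCoeff (B p) p (i.2 p p.2) with hc
  have hLS := dual_large_sieve (sieveIndex 𝒮) sieveFreq c N hN
    (sieveFreq_separated 𝒮 hprime N hQ)
  have hval : ∀ g ∈ G, ∑ i ∈ sieveIndex 𝒮, c i * expTwoPi (sieveFreq i * g) = (L : ℂ) := by
    intro g hg
    rw [sieveIndex, sum_sigma, hL]
    push_cast
    refine sum_congr rfl fun S hS => ?_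
    have h1 : ∀ a ∈ S.pi fun p => Icc 1 (p - 1),
        c ⟨S, a⟩ * expTwoPi (sieveFreq ⟨S, a⟩ * g) = w S * ∏ p ∈ S.attach,
          (sieveCoeff (B p) p (a p p.2) * expTwoPi ((a p p.2 : ℝ) / (p : ℕ) * g)) := by
      intro a _
      simp only [hc, sieveFreq]
      rw [sum_mul, expTwoPi_sum, prod_mul_distrib, mul_assoc]
    rw [sum_congr rfl h1, ← mul_sum,
      ← prod_sum S (fun p => Icc 1 (p - 1))
        (fun p a => sieveCoeff (B p) p a * expTwoPi ((a : ℝ) / (p : ℕ) * g)),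
      prod_congr rfl fun p hp => sum_sieveCoeff_mul_expTwoPi (B p) (hB S hS p hp) p
        (hprime S hS p hp).pos g (hGB g hg S hS p hp)]
    simp
  have hcoef : ∑ i ∈ sieveIndex 𝒮, ‖c i‖ ^ 2 = L := by
    rw [sieveIndex, sum_sigma, hL]
    refine sum_congr rfl fun S hS => ?_
    have h1 : ∀ a ∈ S.pi fun p => Icc 1 (p - 1),
        ‖c ⟨S, a⟩‖ ^ 2 = w S ^ 2 * ∏ p ∈ S.attach, ‖sieveCoeff (B p) p (a p p.2)‖ ^ 2 := by
      intro a _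
      simp only [hc]
      rw [norm_mul, mul_pow, norm_prod, prod_pow, Complex.norm_real, Real.norm_eq_abs, sq_abs]
    rw [sum_congr rfl h1, ← mul_sum,
      ← prod_sum S (fun p => Icc 1 (p - 1)) (fun p a => ‖sieveCoeff (B p) p a‖ ^ 2),
      prod_congr rfl fun p hp => sum_norm_sq_sieveCoeff (B p) (hB S hS p hp) p
        (hprime S hS p hp).pos (hinj S hS p hp)]
    have h2 : ∏ p ∈ S, ((p : ℝ) - (B p).card) / (B p).card = (w S)⁻¹ := by
      simp only [hw]
      rw [← prod_inv_distrib]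
      refine prod_congr rfl fun p _ => ?_
      rw [inv_div]
    rw [h2, sq, mul_assoc, mul_inv_cancel₀ (hwpos S hS).ne', mul_one]
  have h1 : (G.card : ℝ) * L ^ 2 ≤ 5 * N * L := by
    calc (G.card : ℝ) * L ^ 2 =
          ∑ g ∈ G, ‖∑ i ∈ sieveIndex 𝒮, c i * expTwoPi (sieveFreq i * g)‖ ^ 2 := by
          rw [sum_congr rfl fun g hg => by rw [hval g hg]]
          simp [sq_abs]
      _ ≤ ∑ n ∈ Icc 1 N, ‖∑ i ∈ sieveIndex 𝒮, c i * expTwoPi (sieveFreq i * n)‖ ^ 2 :=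
          sum_le_sum_of_subset_of_nonneg hG fun _ _ _ => by positivity
      _ ≤ _ := by rw [← hcoef]; exact hLS
  rcases 𝒮.eq_empty_or_nonempty with rfl | hne
  · simp [hL]
  · have hLpos : 0 < L := sum_pos hwpos hne
    have h2 : (G.card * L) * L ≤ 5 * N * L := by linarith [h1, sq L]
    exact le_of_mul_le_mul_right h2 hLpos

end ArithmeticSieve

/-! ### Lower bounds for sums of products over subsets -/

section SubsetSums

open Finset

/-- For weights in `[0, 1]` of sum `E`, the `m`-th elementary symmetric sum is at least
`(E - m)^m / m!`. -/
lemma max_sub_pow_le_factorial_mul_sum_powersetCard {ι : Type*} [DecidableEq ι] (P : Finset ι)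
    (u : ι → ℝ) (h0 : ∀ p ∈ P, 0 ≤ u p) (h1 : ∀ p ∈ P, u p ≤ 1) (m : ℕ) :
    max (∑ p ∈ P, u p - m) 0 ^ m ≤ m.factorial * ∑ S ∈ P.powersetCard m, ∏ p ∈ S, u p := by
  induction P using Finset.induction_on generalizing m with
  | empty =>
    rcases m with _ | m
    · simp
    · have : max (∑ p ∈ (∅ : Finset ι), u p - ((m + 1 : ℕ) : ℝ)) 0 = 0 := by
        rw [sum_empty]; apply max_eq_right; push_cast; linarith [(Nat.cast_nonneg m : (0 : ℝ) ≤ m)]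
      rw [this, zero_pow m.succ_ne_zero]
      exact mul_nonneg (Nat.cast_nonneg _) (sum_nonneg fun S hS => prod_nonneg fun p hp =>
        h0 p ((mem_powersetCard.1 hS).1 hp))
  | insert a P ha ih =>
    rcases m with _ | m
    · simp
    have ih0 : ∀ m : ℕ, max (∑ p ∈ P, u p - m) 0 ^ m ≤
        m.factorial * ∑ S ∈ P.powersetCard m, ∏ p ∈ S, u p :=
      ih (fun p hp => h0 p (mem_insert_of_mem hp)) (fun p hp => h1 p (mem_insert_of_mem hp))
    have ha0 := h0 a (mem_insert_self a P)
    have ha1 := h1 a (mem_insert_self a P)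
    have hsplit : ∑ S ∈ (insert a P).powersetCard (m + 1), ∏ p ∈ S, u p =
        ∑ S ∈ P.powersetCard (m + 1), ∏ p ∈ S, u p +
          u a * ∑ S ∈ P.powersetCard m, ∏ p ∈ S, u p := by
      have hnot : ∀ S ∈ P.powersetCard m, a ∉ S := fun S hS haS =>
        ha ((mem_powersetCard.1 hS).1 haS)
      rw [powersetCard_succ_insert ha, sum_union, sum_image, mul_sum]
      · congr 1
        exact sum_congr rfl fun S hS => prod_insert (hnot S hS)
      · intro S hS T hT hST
        rw [← erase_insert (hnot S hS), hST, erase_insert (hnot T hT)]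
      · rw [disjoint_left]
        intro S hS hS'
        obtain ⟨T, _, rfl⟩ := mem_image.1 hS'
        exact ha ((mem_powersetCard.1 hS).1 (mem_insert_self a T))
    have i1 := ih0 (m + 1)
    have i2 := ih0 m
    rw [hsplit, sum_insert ha]
    set E := ∑ p ∈ P, u p
    push_cast at i1 ⊢
    set φ := max (E - (m + 1)) 0 with hφ
    set φ' := max (u a + E - (m + 1)) 0 with hφ'
    set ψ := max (E - m) 0 with hψ
    have a1 : φ' ≤ ψ := max_le_max (by linarith) le_rfl
    have a2 : φ' - φ ≤ u a := by
      rw [sub_le_iff_le_add]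
      refine max_le ?_ (add_nonneg ha0 (le_max_right _ _))
      have := le_max_left (E - (m + 1)) 0
      linarith
    have a3 : φ ≤ φ' := max_le_max (by linarith) le_rfl
    have a4 : 0 ≤ φ := le_max_right _ _
    have a5 := abs_pow_sub_pow_le φ' φ (m + 1)
    rw [abs_of_nonneg (sub_nonneg.2 (pow_le_pow_left₀ a4 a3 _)), abs_of_nonneg (sub_nonneg.2 a3),
      abs_of_nonneg a4, abs_of_nonneg (a4.trans a3), max_eq_left a3, Nat.add_sub_cancel] at a5
    have a6 : (φ' - φ) * ((m + 1 : ℕ) : ℝ) * φ' ^ m ≤ u a * (m + 1 : ℕ) * ψ ^ m := by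
      have := pow_le_pow_left₀ (a4.trans a3) a1 m
      have h2 : 0 ≤ φ' ^ m := pow_nonneg (a4.trans a3) m
      gcongr
    have a7 : u a * (m + 1 : ℕ) * ψ ^ m ≤ u a * (m + 1 : ℕ) *
        (m.factorial * ∑ S ∈ P.powersetCard m, ∏ p ∈ S, u p) := by gcongr
    have a8 : ((m + 1).factorial : ℝ) = (m + 1) * m.factorial := by
      rw [Nat.factorial_succ]; push_cast; ring
    rw [a8] at i1 ⊢
    push_cast at a5 a6 a7
    linarith

lemma sum_powerset_card_mul_prod {ι : Type*} [DecidableEq ι] (P : Finset ι) (w : ι → ℝ)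
    (h0 : ∀ p ∈ P, 0 ≤ w p) :
    ∑ S ∈ P.powerset, (S.card : ℝ) * ∏ p ∈ S, w p =
      (∏ p ∈ P, (1 + w p)) * ∑ p ∈ P, w p / (1 + w p) := by
  induction P using Finset.induction_on with
  | empty => simp
  | insert a P ha ih =>
    have ih0 := ih fun p hp => h0 p (mem_insert_of_mem hp)
    have ha0 := h0 a (mem_insert_self a P)
    have hnot : ∀ S ∈ P.powerset, a ∉ S := fun S hS haS => ha (mem_powerset.1 hS haS)
    have h1 : ∑ S ∈ P.powerset, ((insert a S).card : ℝ) * ∏ p ∈ insert a S, w p =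
        w a * (∑ S ∈ P.powerset, (S.card : ℝ) * ∏ p ∈ S, w p) +
          w a * ∏ p ∈ P, (1 + w p) := by
      rw [prod_one_add, mul_sum, mul_sum, ← sum_add_distrib]
      refine sum_congr rfl fun S hS => ?_
      rw [card_insert_of_notMem (hnot S hS), prod_insert (hnot S hS)]
      push_cast; ring
    rw [sum_powerset_insert ha, h1, ih0, prod_insert ha, sum_insert ha]
    have : 1 + w a ≠ 0 := by positivity
    field_simp
    ring

/-- If the mean size of a random subset, weighted by `∏ w`, is at most `J / 2`, then subsets of
size at most `J` carry half of the total weight `∏ (1 + w)`. -/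
lemma half_prod_le_sum_powerset_card_le {ι : Type*} [DecidableEq ι] (P : Finset ι) (w : ι → ℝ)
    (h0 : ∀ p ∈ P, 0 ≤ w p) (J : ℕ) (hJ : 2 * ∑ p ∈ P, w p / (1 + w p) ≤ J) :
    (∏ p ∈ P, (1 + w p)) / 2 ≤ ∑ S ∈ P.powerset with S.card ≤ J, ∏ p ∈ S, w p := by
  have hZ : 0 < ∏ p ∈ P, (1 + w p) := prod_pos fun p hp => by linarith [h0 p hp]
  have hw : ∀ S ∈ P.powerset, 0 ≤ ∏ p ∈ S, w p := fun S hS =>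
    prod_nonneg fun p hp => h0 p (mem_powerset.1 hS hp)
  have h1 := sum_filter_add_sum_filter_not P.powerset (fun S => S.card ≤ J)
    (fun S => ∏ p ∈ S, w p)
  rw [← prod_one_add] at h1
  have h2 : ((J : ℝ) + 1) * ∑ S ∈ P.powerset with ¬ S.card ≤ J, ∏ p ∈ S, w p ≤
      (∏ p ∈ P, (1 + w p)) * ∑ p ∈ P, w p / (1 + w p) := by
    rw [← sum_powerset_card_mul_prod P w h0, mul_sum]
    refine (sum_le_sum fun S hS => ?_).trans
      (sum_le_sum_of_subset_of_nonneg (filter_subset (fun S : Finset ι => ¬ S.card ≤ J) _)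
        fun S hS _ => mul_nonneg (Nat.cast_nonneg _) (hw S hS))
    obtain ⟨hS1, hS2⟩ := mem_filter.1 hS
    have h3 : (J : ℝ) + 1 ≤ S.card := by exact_mod_cast not_le.1 hS2
    exact mul_le_mul_of_nonneg_right h3 (hw S hS1)
  have h3 : (∏ p ∈ P, (1 + w p)) * ∑ p ∈ P, w p / (1 + w p) ≤ (∏ p ∈ P, (1 + w p)) * (J / 2) := by
    gcongr; linarith
  have hJ0 : (0 : ℝ) ≤ J := Nat.cast_nonneg J
  have h4 : 0 ≤ ∑ S ∈ P.powerset with ¬ S.card ≤ J, ∏ p ∈ S, w p :=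
    sum_nonneg fun S hS => hw S (mem_filter.1 hS).1
  have h5 : ∑ S ∈ P.powerset with ¬ S.card ≤ J, ∏ p ∈ S, w p ≤ (∏ p ∈ P, (1 + w p)) / 2 := by
    by_contra hcon
    rw [not_le] at hcon
    nlinarith
  linarith

end SubsetSums

/-! ### Chebyshev and Mertens type estimates -/

section PrimeSums

open Finset Chebyshev

/-- Chebyshev's lower bound, valid from `2` on with an unspecified constant. -/
lemma exists_pos_mul_le_theta : ∃ c : ℝ, 0 < c ∧ ∀ n : ℕ, 2 ≤ n → c * n ≤ θ n := by
  have hlim : Filter.Tendsto (fun x : ℝ => (Real.log (x + 1) + 2 * √x * Real.log x) / x)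
      Filter.atTop (nhds 0) := by
    have h1 : (fun x : ℝ => Real.log (x + 1)) =o[Filter.atTop] (fun x => x) := by
      have h := Real.isLittleO_log_id_atTop.comp_tendsto
        (Filter.tendsto_atTop_add_const_right Filter.atTop (1 : ℝ) Filter.tendsto_id)
      refine h.trans_isBigO ?_
      refine Asymptotics.IsBigO.of_bound 2 ?_
      filter_upwards [Filter.eventually_ge_atTop 1] with x hx
      simp only [Function.comp, id, Real.norm_eq_abs]
      rw [abs_of_nonneg (by linarith), abs_of_nonneg (by linarith)]
      linarith
    have h2 : (fun x : ℝ => 2 * √x * Real.log x) =o[Filter.atTop] (fun x => x) := by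
      have h := (Asymptotics.isBigO_refl (fun x : ℝ => 2 * √x) Filter.atTop).mul_isLittleO
        (isLittleO_log_rpow_atTop (r := 1 / 2) (by norm_num))
      refine h.trans_isBigO (Asymptotics.IsBigO.of_bound 2 ?_)
      filter_upwards [Filter.eventually_ge_atTop 0] with x hx
      rw [← Real.sqrt_eq_rpow, mul_assoc, Real.mul_self_sqrt hx, norm_mul, Real.norm_two]
    exact (h1.add h2).tendsto_div_nhds_zero
  have hl2 : 0 < Real.log 2 := Real.log_pos one_lt_two
  have hev := (hlim.comp tendsto_natCast_atTop_atTop).eventually_lt_const (half_pos hl2)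
  obtain ⟨n₀, hn₀⟩ := Filter.eventually_atTop.1 hev
  set M : ℝ := max n₀ 2 with hM
  have hM2 : (2 : ℝ) ≤ M := le_max_right _ _
  refine ⟨Real.log 2 / M, by positivity, fun n hn => ?_⟩
  have hn0 : (0 : ℝ) < n := by positivity
  rcases le_total n₀ n with h | h
  · have h1 := hn₀ n h
    simp only [Function.comp] at h1
    rw [div_lt_iff₀ hn0] at h1
    have h2 := theta_ge n
    have h3 : Real.log 2 / M ≤ Real.log 2 / 2 := by gcongr
    have h4 : Real.log 2 / M * n ≤ Real.log 2 / 2 * n := by gcongr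
    linarith
  · have h1 : (n : ℝ) ≤ M := le_trans (by exact_mod_cast h) (le_max_left _ _)
    have h2 : Real.log 2 / M * n ≤ Real.log 2 := by
      rw [div_mul_eq_mul_div, div_le_iff₀ (by linarith)]; gcongr
    have h3 : θ 2 ≤ θ n := theta_mono (by exact_mod_cast hn)
    have h4 : Real.log 2 ≤ θ 2 := by
      rw [theta_eq_sum_Icc]
      simp only [Nat.floor_ofNat]
      exact single_le_sum (f := fun p : ℕ => Real.log p)
        (fun p _ => Real.log_natCast_nonneg p) (a := 2) (by simp [Nat.prime_two])
    linarith

/-- Mertens' first theorem, upper bound. -/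
lemma sum_log_div_primesLE_le (n : ℕ) (hn : 1 ≤ n) :
    ∑ p ∈ n.primesLE, Real.log p / p ≤ Real.log n + Real.log 4 := by
  have hfact : ∑ p ∈ n.primesLE, (n / p : ℕ) * Real.log p ≤ Real.log n.factorial := by
    have h1 : (∏ p ∈ n.primesLE, p ^ (n / p)) ∣ n.factorial := by
      refine prod_dvd_of_isRelPrime (fun p hp q hq hpq => ?_) fun p hp => ?_
      · rw [Function.onFun, ← Nat.coprime_iff_isRelPrime]
        exact Nat.Coprime.pow _ _ ((Nat.coprime_primes (Nat.prime_of_mem_primesLE hp)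
          (Nat.prime_of_mem_primesLE hq)).2 hpq)
      · rw [(Nat.prime_of_mem_primesLE hp).pow_dvd_factorial_iff (b := Nat.log p n + 2) (by omega)]
        refine le_trans (by rw [pow_one]) (single_le_sum (f := fun i => n / p ^ i)
          (fun _ _ => Nat.zero_le _) (a := 1) (by simp))
    have h2 := Nat.le_of_dvd n.factorial_pos h1
    have h3 : ((∏ p ∈ n.primesLE, p ^ (n / p) : ℕ) : ℝ) ≤ n.factorial := by exact_mod_cast h2
    have hpos : ∀ p ∈ n.primesLE, (p : ℝ) ^ (n / p) ≠ 0 := fun p hp =>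
      pow_ne_zero _ (by exact_mod_cast (Nat.prime_of_mem_primesLE hp).ne_zero)
    have h4 := Real.log_le_log (by
      push_cast
      exact prod_pos fun p hp => pow_pos
        (by exact_mod_cast (Nat.prime_of_mem_primesLE hp).pos) _) h3
    push_cast at h4
    rw [Real.log_prod hpos] at h4
    simpa only [Real.log_pow] using h4
  have hfact2 : Real.log n.factorial ≤ n * Real.log n := by
    rw [← Real.log_pow]
    refine Real.log_le_log (by exact_mod_cast n.factorial_pos) ?_
    exact_mod_cast Nat.factorial_le_pow n
  have htheta := theta_le_log4_mul_x (x := (n : ℝ)) (by positivity)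
  rw [theta_eq_sum_primesLE_log] at htheta
  have hn0 : (0 : ℝ) < n := by exact_mod_cast hn
  have hterm : ∀ p ∈ n.primesLE, n * (Real.log p / p) ≤
      (n / p : ℕ) * Real.log p + Real.log p := by
    intro p hp
    have hp0 := (Nat.prime_of_mem_primesLE hp).pos
    have h1 : (n : ℝ) / p ≤ (n / p : ℕ) + 1 := by
      rw [← Nat.floor_div_eq_div (K := ℝ)]
      exact (Nat.lt_floor_add_one _).le
    have h2 : 0 ≤ Real.log p := Real.log_natCast_nonneg p
    calc n * (Real.log p / p) = (n / p : ℝ) * Real.log p := by ring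
      _ ≤ ((n / p : ℕ) + 1) * Real.log p := by gcongr
      _ = _ := by ring
  have hsum := sum_le_sum hterm
  rw [← mul_sum, sum_add_distrib] at hsum
  have : n * (∑ p ∈ n.primesLE, Real.log p / p) ≤ n * (Real.log n + Real.log 4) := by linarith
  exact le_of_mul_le_mul_left this hn0

/-- Passing from `2 ^ 2 ^ i` to its square adds at most `4`, by the bound for `∑ log p / p`. -/
lemma sum_inv_primesLE_two_pow_le (i : ℕ) :
    ∑ p ∈ Nat.primesLE (2 ^ 2 ^ i), 1 / (p : ℝ) ≤ 4 * i + 1 := by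
  induction i with
  | zero =>
    have : Nat.primesLE (2 ^ 2 ^ 0) = {2} := by decide
    rw [this]; norm_num
  | succ i ih =>
    have hsub : Nat.primesLE (2 ^ 2 ^ i) ⊆ Nat.primesLE (2 ^ 2 ^ (i + 1)) :=
      Nat.primesLE_mono (Nat.pow_le_pow_right two_pos (Nat.pow_le_pow_right two_pos i.le_succ))
    rw [← sum_sdiff hsub]
    have hl2 : 0 < Real.log 2 := Real.log_pos one_lt_two
    have hpow : (0 : ℝ) < 2 ^ i := by positivity
    have h1 : ∀ p ∈ Nat.primesLE (2 ^ 2 ^ (i + 1)) \ Nat.primesLE (2 ^ 2 ^ i),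
        1 / (p : ℝ) ≤ (1 / (2 ^ i * Real.log 2)) * (Real.log p / p) := by
      intro p hp
      obtain ⟨hp1, hp2⟩ := mem_sdiff.1 hp
      have hpr := Nat.prime_of_mem_primesLE hp1
      have hp0 : (0 : ℝ) < p := by exact_mod_cast hpr.pos
      have h2 : 2 ^ 2 ^ i < p := by
        by_contra h
        exact hp2 (Nat.mem_primesLE.2 ⟨not_lt.1 h, hpr⟩)
      have h3 : 2 ^ i * Real.log 2 ≤ Real.log p := by
        have h4 : (2 : ℝ) ^ 2 ^ i ≤ p := by exact_mod_cast h2.le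
        have h5 := Real.log_le_log (by positivity) h4
        rw [Real.log_pow] at h5
        push_cast at h5
        exact h5
      rw [div_mul_div_comm, one_mul, div_le_div_iff₀ hp0 (by positivity)]
      nlinarith
    have h2 := sum_le_sum h1
    have h3 := sum_log_div_primesLE_le (2 ^ 2 ^ (i + 1)) Nat.one_le_two_pow
    have h4 : ∑ p ∈ Nat.primesLE (2 ^ 2 ^ (i + 1)) \ Nat.primesLE (2 ^ 2 ^ i), Real.log p / p ≤
        ∑ p ∈ Nat.primesLE (2 ^ 2 ^ (i + 1)), Real.log p / p :=
      sum_le_sum_of_subset_of_nonneg sdiff_subset fun p _ _ =>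
        div_nonneg (Real.log_natCast_nonneg p) (Nat.cast_nonneg p)
    have h5 : Real.log ((2 ^ 2 ^ (i + 1) : ℕ) : ℝ) + Real.log 4 ≤ 4 * (2 ^ i * Real.log 2) := by
      have h6 : Real.log 4 = 2 * Real.log 2 := by
        rw [show (4 : ℝ) = 2 ^ 2 by norm_num, Real.log_pow]; norm_num
      have h7 : (1 : ℝ) ≤ 2 ^ i := one_le_pow₀ one_le_two
      push_cast
      rw [Real.log_pow, h6]
      push_cast
      rw [pow_succ]
      nlinarith
    rw [← mul_sum] at h2
    have h6 : (1 / (2 ^ i * Real.log 2)) *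
        ∑ p ∈ Nat.primesLE (2 ^ 2 ^ (i + 1)) \ Nat.primesLE (2 ^ 2 ^ i), Real.log p / p
          ≤ (1 / (2 ^ i * Real.log 2)) * (4 * (2 ^ i * Real.log 2)) := by
      gcongr; linarith
    have h7 : (1 / (2 ^ i * Real.log 2)) * (4 * (2 ^ i * Real.log 2)) = 4 := by field_simp
    push_cast
    linarith

/-- The sum of reciprocals of the primes up to `t` is `O(log log t)`. -/
lemma sum_inv_primesLE_le (t : ℝ) (ht : 2 ≤ t) :
    ∑ p ∈ ⌊t⌋₊.primesLE, 1 / (p : ℝ) ≤ 4 * Real.logb 2 (Real.logb 2 t) + 5 := by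
  have h1 : 1 ≤ Real.logb 2 t := by
    rw [Real.le_logb_iff_rpow_le one_lt_two (by linarith)]; simpa using ht
  have h2 : 0 ≤ Real.logb 2 (Real.logb 2 t) := Real.logb_nonneg one_lt_two h1
  set i := ⌈Real.logb 2 (Real.logb 2 t)⌉₊ with hi
  have h3 : (i : ℝ) < Real.logb 2 (Real.logb 2 t) + 1 := Nat.ceil_lt_add_one h2
  have h4 : Real.logb 2 t ≤ 2 ^ i := by
    have := (Real.logb_le_iff_le_rpow one_lt_two (lt_of_lt_of_le one_pos h1)).1 (Nat.le_ceil _)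
    rwa [Real.rpow_natCast] at this
  have h5 : t ≤ ((2 ^ 2 ^ i : ℕ) : ℝ) := by
    have : Real.logb 2 t ≤ ((2 ^ i : ℕ) : ℝ) := by push_cast; exact h4
    have := (Real.logb_le_iff_le_rpow one_lt_two (by linarith)).1 this
    rw [Real.rpow_natCast] at this
    exact_mod_cast this
  have h6 : ∑ p ∈ ⌊t⌋₊.primesLE, 1 / (p : ℝ) ≤ ∑ p ∈ Nat.primesLE (2 ^ 2 ^ i), 1 / (p : ℝ) :=
    sum_le_sum_of_subset_of_nonneg (Nat.primesLE_mono (Nat.floor_le_of_le h5))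
      fun p _ _ => by positivity
  have h7 := sum_inv_primesLE_two_pow_le i
  linarith

lemma eventually_sum_inv_primesLE_le_rpow (ε : ℝ) (hε : 0 < ε) :
    ∀ᶠ t : ℝ in Filter.atTop, ∑ p ∈ ⌊t⌋₊.primesLE, 1 / (p : ℝ) ≤ Real.log t ^ ε := by
  have hl2 : 0 < Real.log 2 := Real.log_pos one_lt_two
  have h1 : (fun s : ℝ => 4 / Real.log 2 * Real.log s + 5) =o[Filter.atTop] (fun s => s ^ ε) := by
    refine ((isLittleO_log_rpow_atTop hε).const_mul_left _).add ?_
    exact Asymptotics.isLittleO_const_left.2 (Or.inr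
      (Filter.tendsto_abs_atTop_atTop.comp (tendsto_rpow_atTop hε)))
  have h2 := h1.bound (c := Real.log 2 ^ ε) (by positivity)
  have h3 : Filter.Tendsto (fun t : ℝ => Real.logb 2 t) Filter.atTop Filter.atTop :=
    Real.tendsto_logb_atTop one_lt_two
  filter_upwards [h3.eventually h2, Filter.eventually_ge_atTop 2, h3.eventually_ge_atTop 1]
    with t ht ht2 ht1
  refine (sum_inv_primesLE_le t ht2).trans ?_
  have h4 : 4 * Real.logb 2 (Real.logb 2 t) + 5 ≤
      ‖4 / Real.log 2 * Real.log (Real.logb 2 t) + 5‖ := by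
    refine le_trans (le_of_eq ?_) (le_abs_self _)
    rw [← Real.log_div_log]; ring
  refine (h4.trans ht).trans (le_of_eq ?_)
  rw [Real.norm_of_nonneg (by positivity), ← Real.mul_rpow hl2.le (by linarith),
    ← Real.log_div_log, mul_div_cancel₀ _ hl2.ne']

/-- The Euler product over the primes up to `n` exceeds the harmonic sum. -/
lemma log_le_prod_primesLE (n : ℕ) :
    Real.log (n + 1) ≤ ∏ p ∈ n.primesLE, (1 - 1 / (p : ℝ))⁻¹ := by
  set f : ℕ →* ℝ :=
    { toFun := fun n => ((n : ℝ))⁻¹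
      map_one' := by simp
      map_mul' := fun a b => by push_cast; rw [mul_inv] } with hf
  have h1 := (EulerProduct.summable_and_hasSum_smoothNumbers_prod_primesBelow_geometric (f := f)
    (fun {p} hp => by
      have : (1 : ℝ) < p := by exact_mod_cast hp.one_lt
      simp only [hf, MonoidHom.coe_mk, OneHom.coe_mk, norm_inv, Real.norm_natCast]
      exact inv_lt_one_of_one_lt₀ this) (n + 1)).2
  have hmem : ∀ i ∈ range n, i + 1 ∈ (n + 1).smoothNumbers := fun i hi =>
    Nat.mem_smoothNumbers_of_lt i.succ_pos (by rw [mem_range] at hi; omega)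
  have h2 := sum_le_hasSum ((range n).attach.map
    ⟨fun i : range n => (⟨(i : ℕ) + 1, hmem i i.2⟩ : (n + 1).smoothNumbers), fun a b hab =>
      Subtype.ext (Nat.succ_injective (congrArg Subtype.val hab))⟩)
    (fun m _ => by
      simp only [hf, MonoidHom.coe_mk, OneHom.coe_mk]; positivity) h1
  rw [sum_map] at h2
  have h3 : Real.log (n + 1) ≤ ∑ i ∈ (range n).attach, (((i : ℕ) + 1 : ℕ) : ℝ)⁻¹ := by
    rw [sum_attach (range n) (fun i => ((i + 1 : ℕ) : ℝ)⁻¹)]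
    have := log_add_one_le_harmonic n
    rw [harmonic] at this
    push_cast at this ⊢
    exact this
  refine (h3.trans h2).trans (le_of_eq ?_)
  refine prod_congr rfl fun p _ => ?_
  simp [hf]

end PrimeSums

/-! ### Residue classes of `F` and the larger sieve -/

section Residues

open Finset Chebyshev

/-- The residues in `[0, p)` occupied by `F` modulo `p`. -/
def residues (F : Finset ℕ) (p : ℕ) : Finset ℕ := F.image (· % p)

lemma residues_nonempty {F : Finset ℕ} (hF : F.Nonempty) (p : ℕ) : (residues F p).Nonempty :=
  hF.image _

lemma residues_subset_range (F : Finset ℕ) {p : ℕ} (hp : 0 < p) : residues F p ⊆ range p := by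
  intro b hb
  obtain ⟨f, _, rfl⟩ := mem_image.1 hb
  exact mem_range.2 (Nat.mod_lt _ hp)

lemma card_residues_lt {F : Finset ℕ} {p g : ℕ} (hp : 0 < p) (hg : ∀ f ∈ F, ¬ p ∣ g + f) :
    (residues F p).card < p := by
  have hmem : (p - g % p) % p ∉ residues F p := by
    intro h
    obtain ⟨f, hf, hfp⟩ := mem_image.1 h
    apply hg f hf
    have h1 : (g + f) % p = (g % p + (p - g % p)) % p := by
      rw [Nat.add_mod, hfp]; simp [Nat.add_mod]
    rw [Nat.add_sub_of_le (Nat.mod_lt g hp).le, Nat.mod_self] at h1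
    exact Nat.dvd_of_mod_eq_zero h1
  have hss : residues F p ⊂ range p :=
    (ssubset_iff_of_subset (residues_subset_range F hp)).2
      ⟨_, mem_range.2 (Nat.mod_lt _ hp), hmem⟩
  simpa using card_lt_card hss

/-- The large sieve for a set `G` whose sums with `F` avoid the multiples of small primes. -/
lemma card_mul_sum_prod_residues_le (𝒮 : Finset (Finset ℕ)) (hprime : ∀ S ∈ 𝒮, ∀ p ∈ S, p.Prime)
    (N : ℕ) (hN : 0 < N) (hQ : ∀ S ∈ 𝒮, (∏ p ∈ S, p) ^ 2 ≤ N) (F G : Finset ℕ)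
    (hF : F.Nonempty) (hG : G ⊆ Icc 1 N)
    (hFG : ∀ f ∈ F, ∀ g ∈ G, ∀ p : ℕ, p.Prime → p ^ 2 ≤ N → ¬ p ∣ g + f) :
    (G.card : ℝ) * ∑ S ∈ 𝒮, ∏ p ∈ S, ((residues F p).card : ℝ) / (p - (residues F p).card) ≤
      5 * N := by
  rcases G.eq_empty_or_nonempty with rfl | ⟨g₀, hg₀⟩
  · simp
  have hsmall : ∀ S ∈ 𝒮, ∀ p ∈ S, p ^ 2 ≤ N := by
    intro S hS p hp
    refine le_trans (Nat.pow_le_pow_left ?_ 2) (hQ S hS)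
    exact Nat.le_of_dvd (prod_pos fun q hq => (hprime S hS q hq).pos) (dvd_prod_of_mem _ hp)
  refine arithmetic_large_sieve 𝒮 hprime N hN hQ G hG (residues F)
    (fun S _ p _ => residues_nonempty hF p)
    (fun S hS p hp => card_residues_lt (hprime S hS p hp).pos fun f hf =>
      hFG f hf g₀ hg₀ p (hprime S hS p hp) (hsmall S hS p hp)) ?_ ?_
  · intro S hS p hp b hb b' hb' hd
    have h1 := mem_range.1 (residues_subset_range F (hprime S hS p hp).pos hb)
    have h2 := mem_range.1 (residues_subset_range F (hprime S hS p hp).pos hb')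
    have := Int.eq_zero_of_abs_lt_dvd hd (by rw [abs_lt]; omega)
    omega
  · intro g hg S hS p hp b hb hd
    obtain ⟨f, hf, rfl⟩ := mem_image.1 hb
    refine hFG f hf g hg p (hprime S hS p hp) (hsmall S hS p hp) ?_
    rw [Nat.dvd_iff_mod_eq_zero] at hd ⊢
    simpa [Nat.add_mod] using hd

lemma sum_log_primes_dvd_sub_le (P : Finset ℕ) (hP : ∀ p ∈ P, p.Prime) (N f f' : ℕ)
    (hf : f ∈ Icc 1 N) (hf' : f' ∈ Icc 1 N) (hne : f ≠ f') :
    ∑ p ∈ P with f % p = f' % p, Real.log p ≤ Real.log N := by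
  rw [mem_Icc] at hf hf'
  set d := ((f : ℤ) - f').natAbs with hd
  have hd0 : 0 < d := by omega
  have hdN : d ≤ N := by omega
  have hdvd : (∏ p ∈ P with f % p = f' % p, p) ∣ d := by
    refine prod_primes_dvd d (fun p hp => (hP p (mem_filter.1 hp).1).prime) fun p hp => ?_
    have h1 : f' ≡ f [MOD p] := (mem_filter.1 hp).2.symm
    exact Int.natCast_dvd.1 ((Nat.modEq_iff_dvd).1 h1)
  have h1 := (Nat.le_of_dvd hd0 hdvd).trans hdN
  rw [← Real.log_prod fun p hp => by exact_mod_cast (hP p (mem_filter.1 hp).1).ne_zero]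
  rw [← Nat.cast_prod]
  refine Real.log_le_log ?_ (Nat.cast_le.2 h1)
  exact Nat.cast_pos.2 <| prod_pos fun p hp => (hP p (mem_filter.1 hp).1).pos

lemma card_sq_le_card_residues_mul (F : Finset ℕ) (p : ℕ) :
    (F.card : ℝ) ^ 2 ≤ (residues F p).card *
      (F.card + ((F.offDiag.filter fun z => z.1 % p = z.2 % p).card : ℝ)) := by
  set Z : ℕ → ℝ := fun b => ((F.filter fun f => f % p = b).card : ℝ) with hZ
  have h1 : (F.card : ℝ) = ∑ b ∈ residues F p, Z b := by
    have := card_eq_sum_card_image (· % p) F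
    simp only [hZ]
    exact_mod_cast this
  have h2 : (F.card + ((F.offDiag.filter fun z => z.1 % p = z.2 % p).card : ℝ)) =
      ∑ b ∈ residues F p, Z b ^ 2 := by
    have h3 : ∑ b ∈ residues F p, Z b ^ 2 =
        ∑ f ∈ F, ((F.filter fun f' => f' % p = f % p).card : ℝ) := by
      rw [← sum_fiberwise_of_maps_to (s := F) (t := residues F p) (g := (· % p))
        (fun f hf => mem_image_of_mem _ hf)]
      refine sum_congr rfl fun b _ => ?_
      rw [sum_congr rfl fun f hf => by rw [(mem_filter.1 hf).2]]
      rw [sum_const, nsmul_eq_mul, sq]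
    have h4 : ((F ×ˢ F).filter fun z => z.1 % p = z.2 % p).card =
        ∑ f ∈ F, (F.filter fun f' => f' % p = f % p).card := by
      rw [card_filter, sum_product]
      refine sum_congr rfl fun f _ => ?_
      rw [card_filter]
      simp only [eq_comm]
    have h5 : ((F ×ˢ F).filter fun z => z.1 % p = z.2 % p).card =
        F.card + (F.offDiag.filter fun z => z.1 % p = z.2 % p).card := by
      rw [← diag_union_offDiag, filter_union, card_union_of_disjoint
        (disjoint_filter_filter (disjoint_diag_offDiag F))]
      congr 1
      rw [filter_true_of_mem, diag_card]
      intro z hz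
      rw [(mem_diag.1 hz).2]
    rw [h3]
    exact_mod_cast h5.symm.trans h4
  rw [h1, ← h1, h2, h1]
  exact sq_sum_le_card_mul_sum_sq

/-- Gallagher's larger sieve: `F` cannot occupy few residue classes modulo many primes. -/
lemma sum_log_div_card_residues_le (F : Finset ℕ) (hF : F.Nonempty) (N : ℕ) (hFN : F ⊆ Icc 1 N)
    (y : ℕ) :
    ∑ p ∈ y.primesLE, Real.log p / (residues F p).card ≤ Real.log N + θ y / F.card := by
  have hn : (0 : ℝ) < F.card := by exact_mod_cast hF.card_pos
  have hoff : ∑ p ∈ y.primesLE, Real.log p *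
      ((F.offDiag.filter fun z => z.1 % p = z.2 % p).card : ℝ) ≤ (F.card : ℝ) ^ 2 * Real.log N := by
    have h1 : ∀ p ∈ y.primesLE, Real.log p *
        ((F.offDiag.filter fun z => z.1 % p = z.2 % p).card : ℝ) =
        ∑ z ∈ F.offDiag, if z.1 % p = z.2 % p then Real.log p else 0 := by
      intro p _
      rw [← sum_filter, sum_const, nsmul_eq_mul, mul_comm]
    rw [sum_congr rfl h1, sum_comm]
    have h2 : ∀ z ∈ F.offDiag, (∑ p ∈ y.primesLE, if z.1 % p = z.2 % p then Real.log p else 0) ≤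
        Real.log N := by
      intro z hz
      rw [mem_offDiag] at hz
      rw [← sum_filter]
      exact sum_log_primes_dvd_sub_le _ (fun p hp => Nat.prime_of_mem_primesLE hp) N _ _
        (hFN hz.1) (hFN hz.2.1) hz.2.2
    refine (sum_le_sum h2).trans ?_
    rw [sum_const, nsmul_eq_mul, sq]
    refine mul_le_mul_of_nonneg_right ?_ (Real.log_natCast_nonneg N)
    rw [offDiag_card]
    exact_mod_cast Nat.sub_le _ _
  have hterm : ∀ p ∈ y.primesLE, Real.log p / (residues F p).card ≤
      (Real.log p * F.card + Real.log p *
        ((F.offDiag.filter fun z => z.1 % p = z.2 % p).card : ℝ)) / (F.card : ℝ) ^ 2 := by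
    intro p _
    have h1 : (0 : ℝ) < (residues F p).card := by
      exact_mod_cast (residues_nonempty hF p).card_pos
    have h2 := card_sq_le_card_residues_mul F p
    have h3 := Real.log_natCast_nonneg p
    rw [div_le_div_iff₀ h1 (by positivity)]
    nlinarith
  refine (sum_le_sum hterm).trans ?_
  rw [← sum_div, sum_add_distrib, ← sum_mul, theta_eq_sum_primesLE_log, div_le_iff₀ (by positivity)]
  have : (Real.log N + (∑ p ∈ y.primesLE, Real.log p) / F.card) * (F.card : ℝ) ^ 2 =
      (F.card : ℝ) ^ 2 * Real.log N + (∑ p ∈ y.primesLE, Real.log p) * F.card := by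
    field_simp
  linarith

/-- If `|F| ≥ y / log x`, then `F` occupies on average a proportion `≫ 1 / log x` of the classes
modulo the primes up to `y`: the larger sieve bounds `∑ log p / ν_p`, and the Cauchy–Schwarz
inequality turns this into a lower bound for `∑ ν_p`. -/
lemma mul_le_sum_card_residues_div {c₀ : ℝ} (hc₀ : 0 < c₀) (hθ : ∀ n : ℕ, 2 ≤ n → c₀ * n ≤ θ n)
    {x : ℝ} (hx : 3 ≤ x) {y : ℕ} (hy : 2 ≤ y) {F : Finset ℕ} (hFN : F ⊆ Icc 1 ⌊x⌋₊)
    (hF : F.Nonempty) (hyF : (y : ℝ) ≤ F.card * Real.log x) :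
    c₀ ^ 2 * y ≤ (∑ p ∈ y.primesLE, ((residues F p).card : ℝ) / p) *
      (Real.log y * (3 * Real.log x)) := by
  set N := ⌊x⌋₊ with hN
  have hNx : (N : ℝ) ≤ x := Nat.floor_le (by linarith)
  have hN3 : 3 ≤ N := Nat.le_floor (by exact_mod_cast hx)
  have hlx : 0 < Real.log x := Real.log_pos (by linarith)
  have hy0 : (0 : ℝ) < y := by positivity
  have hn0 : (0 : ℝ) < F.card := by exact_mod_cast hF.card_pos
  have hly : 0 < Real.log y := Real.log_pos (by exact_mod_cast hy)
  set ν : ℕ → ℝ := fun p => ((residues F p).card : ℝ) with hν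
  have hν1 : ∀ p, 1 ≤ ν p := fun p => by
    simp only [hν]; exact_mod_cast (residues_nonempty hF p).card_pos
  have hp0 : ∀ p ∈ y.primesLE, (0 : ℝ) < p := fun p hp => by
    exact_mod_cast (Nat.prime_of_mem_primesLE hp).pos
  have hS1 : ∑ p ∈ y.primesLE, Real.log p / ν p ≤ 3 * Real.log x := by
    have h1 := sum_log_div_card_residues_le F hF N hFN y
    have h2 : Real.log N ≤ Real.log x :=
      Real.log_le_log (by exact_mod_cast (by omega : 0 < N)) hNx
    have h3 : θ y / F.card ≤ 2 * Real.log x := by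
      have h4 := theta_le_log4_mul_x (x := (y : ℝ)) hy0.le
      have h5 : Real.log 4 ≤ 2 := by
        rw [show (4 : ℝ) = 2 ^ 2 by norm_num, Real.log_pow]
        have := Real.log_two_lt_d9
        push_cast; linarith
      rw [div_le_iff₀ hn0]
      nlinarith
    linarith
  set E := ∑ p ∈ y.primesLE, ν p / p with hE
  have hνE : ∑ p ∈ y.primesLE, ν p ≤ y * E := by
    rw [hE, mul_sum]
    refine sum_le_sum fun p hp => ?_
    have h1 : (p : ℝ) ≤ y := by exact_mod_cast Nat.le_of_mem_primesLE hp
    have h2 := hν1 p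
    rw [mul_div_assoc', le_div_iff₀ (hp0 p hp)]
    nlinarith
  have hcs : (c₀ * y) ^ 2 ≤ y * E * (Real.log y * (3 * Real.log x)) := by
    have h1 : (θ y) ^ 2 ≤ (∑ p ∈ y.primesLE, ν p) *
        ∑ p ∈ y.primesLE, Real.log p ^ 2 / ν p := by
      rw [theta_eq_sum_primesLE_log]
      refine sum_sq_le_sum_mul_sum_of_sq_le_mul _ (fun p _ => by positivity)
        (fun p _ => by positivity) fun p _ => ?_
      have := hν1 p
      rw [mul_div_cancel₀ _ (by positivity)]
    have h2 : ∑ p ∈ y.primesLE, Real.log p ^ 2 / ν p ≤ Real.log y * (3 * Real.log x) := by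
      refine le_trans ?_ (mul_le_mul_of_nonneg_left hS1 hly.le)
      rw [mul_sum]
      refine sum_le_sum fun p hp => ?_
      have h3 : Real.log p ≤ Real.log y :=
        Real.log_le_log (hp0 p hp) (by exact_mod_cast Nat.le_of_mem_primesLE hp)
      have h4 : 0 ≤ Real.log p := Real.log_natCast_nonneg p
      have h5 := hν1 p
      rw [mul_div_assoc', sq]
      gcongr
    have h3 : (c₀ * y) ^ 2 ≤ (θ y) ^ 2 := by
      have := hθ y hy
      gcongr
    refine h3.trans (h1.trans ?_)
    have h4 : 0 ≤ ∑ p ∈ y.primesLE, ν p := sum_nonneg fun p _ => by linarith [hν1 p]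
    have h5 : 0 ≤ ∑ p ∈ y.primesLE, Real.log p ^ 2 / ν p := sum_nonneg fun p _ => by positivity
    exact mul_le_mul hνE h2 h5 (h4.trans hνE)
  have h2 : y * (c₀ ^ 2 * y) ≤ y * (E * (Real.log y * (3 * Real.log x))) := by
    rw [show y * (c₀ ^ 2 * y) = (c₀ * y) ^ 2 by ring, ← mul_assoc (y : ℝ) E]
    exact hcs
  exact le_of_mul_le_mul_left h2 hy0

/-- Since `F` occupies many classes modulo the primes up to `y ≤ |F| log x`, the large sieve with
products of `m` such primes bounds `G`. -/
lemma exists_card_mul_pow_le : ∃ c : ℝ, 0 < c ∧ ∀ x : ℝ, 3 ≤ x → ∀ y m : ℕ, 2 ≤ y → 1 ≤ m →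
    y ^ (2 * m) ≤ ⌊x⌋₊ → ∀ F G : Finset ℕ, F ⊆ Icc 1 ⌊x⌋₊ → G ⊆ Icc 1 ⌊x⌋₊ → F.Nonempty →
    (∀ f ∈ F, ∀ g ∈ G, ∀ p : ℕ, p.Prime → p ^ 2 ≤ ⌊x⌋₊ → ¬ p ∣ g + f) →
    (y : ℝ) ≤ F.card * Real.log x → 1 ≤ c * y / Real.log x ^ 2 →
    (G.card : ℝ) * (c * y / Real.log x ^ 2) ^ m ≤ 5 * x := by
  obtain ⟨c₀, hc₀, hθ⟩ := exists_pos_mul_le_theta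
  refine ⟨c₀ ^ 2 / 3, by positivity, ?_⟩
  intro x hx y m hy hm hym F G hFN hGN hF hFG hyF hV
  set N := ⌊x⌋₊ with hN
  set V := c₀ ^ 2 / 3 * y / Real.log x ^ 2 with hVdef
  rcases G.eq_empty_or_nonempty with rfl | ⟨g₀, hg₀⟩
  · simp; linarith
  have hNx : (N : ℝ) ≤ x := Nat.floor_le (by linarith)
  have hN3 : 3 ≤ N := Nat.le_floor (by exact_mod_cast hx)
  have hlx : 1 ≤ Real.log x := by
    rw [Real.le_log_iff_exp_le (by linarith)]
    linarith [Real.exp_one_lt_three]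
  have hm0 : (0 : ℝ) < m := by exact_mod_cast hm
  have hmy : 2 * m * Real.log y ≤ Real.log x := by
    have h1 : ((y ^ (2 * m) : ℕ) : ℝ) ≤ x := le_trans (by exact_mod_cast hym) hNx
    have h2 := Real.log_le_log (by positivity) h1
    push_cast at h2
    rw [Real.log_pow] at h2
    push_cast at h2
    exact h2
  set ν : ℕ → ℝ := fun p => ((residues F p).card : ℝ) with hν
  have hν1 : ∀ p, 1 ≤ ν p := fun p => by
    simp only [hν]; exact_mod_cast (residues_nonempty hF p).card_pos
  have hsmall : ∀ p ∈ y.primesLE, p ^ 2 ≤ N := fun p hp =>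
    ((Nat.pow_le_pow_left (Nat.le_of_mem_primesLE hp) 2).trans
      (Nat.pow_le_pow_right (by omega) (by omega))).trans hym
  have hνp : ∀ p ∈ y.primesLE, ν p < p := fun p hp => by
    simp only [hν]
    exact_mod_cast card_residues_lt (Nat.prime_of_mem_primesLE hp).pos fun f hf =>
      hFG f hf g₀ hg₀ p (Nat.prime_of_mem_primesLE hp) (hsmall p hp)
  have hp0 : ∀ p ∈ y.primesLE, (0 : ℝ) < p := fun p hp => by
    exact_mod_cast (Nat.prime_of_mem_primesLE hp).pos
  set E := ∑ p ∈ y.primesLE, ν p / p with hE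
  -- `log y ≤ log x / (2m)` absorbs the factor `2m`
  have hEV : 2 * m * V ≤ E := by
    have h1 : c₀ ^ 2 * y ≤ E * (Real.log y * (3 * Real.log x)) :=
      mul_le_sum_card_residues_div hc₀ hθ hx hy hFN hF hyF
    have hE0 : 0 ≤ E := sum_nonneg fun p _ => by positivity
    have h2 : 2 * m * (c₀ ^ 2 * y) ≤ E * (3 * Real.log x ^ 2) := by
      have h3 := mul_le_mul_of_nonneg_left h1 (mul_pos two_pos hm0).le
      have h4 := mul_le_mul_of_nonneg_left hmy
        (mul_nonneg hE0 (mul_pos three_pos (one_pos.trans_le hlx)).le)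
      linarith
    have h3 : 2 * m * V = 2 * m * (c₀ ^ 2 * y) / (3 * Real.log x ^ 2) := by
      rw [hVdef]; field_simp
    rw [h3, div_le_iff₀ (by positivity)]
    exact h2
  have hsymm : V ^ m ≤ ∑ S ∈ y.primesLE.powersetCard m, ∏ p ∈ S, ν p / p := by
    have h1 := max_sub_pow_le_factorial_mul_sum_powersetCard y.primesLE (fun p => ν p / p)
      (fun p _ => by positivity) (fun p hp => by
        rw [div_le_one (hp0 p hp)]; exact (hνp p hp).le) m
    have h2 : m * V ≤ max (E - m) 0 := by
      refine le_trans ?_ (le_max_left _ _)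
      nlinarith
    have hV0 : 0 ≤ V := by linarith
    have h3 : (m * V) ^ m ≤ max (E - m) 0 ^ m := pow_le_pow_left₀ (by positivity) h2 m
    have h4 : (m.factorial : ℝ) ≤ (m : ℝ) ^ m := by exact_mod_cast Nat.factorial_le_pow m
    have h5 : 0 ≤ ∑ S ∈ y.primesLE.powersetCard m, ∏ p ∈ S, ν p / p :=
      sum_nonneg fun S _ => prod_nonneg fun p _ => by positivity
    have h6 : (m : ℝ) ^ m * V ^ m ≤
        (m : ℝ) ^ m * ∑ S ∈ y.primesLE.powersetCard m, ∏ p ∈ S, ν p / p := by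
      rw [← mul_pow]
      exact (h3.trans h1).trans (mul_le_mul_of_nonneg_right h4 h5)
    exact le_of_mul_le_mul_left h6 (by positivity)
  have hsieve := card_mul_sum_prod_residues_le (y.primesLE.powersetCard m)
    (fun S hS p hp => Nat.prime_of_mem_primesLE ((mem_powersetCard.1 hS).1 hp)) N (by omega)
    (fun S hS => by
      obtain ⟨h1, h2⟩ := mem_powersetCard.1 hS
      have h3 : ∏ p ∈ S, p ≤ y ^ m := by
        rw [← h2]
        exact prod_le_pow_card _ _ _ fun p hp => Nat.le_of_mem_primesLE (h1 hp)
      calc (∏ p ∈ S, p) ^ 2 ≤ (y ^ m) ^ 2 := Nat.pow_le_pow_left h3 2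
        _ = y ^ (2 * m) := by rw [← pow_mul, mul_comm]
        _ ≤ N := hym) F G hF hGN hFG
  have hmono : ∑ S ∈ y.primesLE.powersetCard m, ∏ p ∈ S, ν p / p ≤
      ∑ S ∈ y.primesLE.powersetCard m, ∏ p ∈ S, ν p / (p - ν p) := by
    refine sum_le_sum fun S hS => prod_le_prod (fun p _ => by positivity) fun p hp => ?_
    have hpy := (mem_powersetCard.1 hS).1 hp
    have h1 := hν1 p
    have h2 := hνp p hpy
    exact div_le_div_of_nonneg_left (by linarith) (by linarith) (by linarith)
  calc (G.card : ℝ) * V ^ m ≤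
        G.card * ∑ S ∈ y.primesLE.powersetCard m, ∏ p ∈ S, ν p / (p - ν p) :=
        mul_le_mul_of_nonneg_left (hsymm.trans hmono) (Nat.cast_nonneg _)
    _ ≤ 5 * N := hsieve
    _ ≤ 5 * x := by linarith

end Residues

/-! ### The sieve by a bounded number of shifts -/

section BoundedShifts

open Finset Filter

lemma card_filter_card_residues_ne_mul_le (P : Finset ℕ) (hP : ∀ p ∈ P, p.Prime) (N : ℕ)
    (F : Finset ℕ) (hF : F ⊆ Icc 1 N) :
    ((P.filter fun p => (residues F p).card ≠ F.card).card : ℝ) * Real.log 2 ≤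
      (F.card : ℝ) ^ 2 * Real.log N := by
  have hsub : (P.filter fun p => (residues F p).card ≠ F.card) ⊆
      F.offDiag.biUnion fun z => P.filter fun p => z.1 % p = z.2 % p := by
    intro p hp
    obtain ⟨hpP, hne⟩ := mem_filter.1 hp
    have h1 : ¬ Set.InjOn (· % p) (F : Set ℕ) := fun h => hne (card_image_of_injOn h)
    simp only [Set.InjOn, not_forall] at h1
    obtain ⟨f, hf, f', hf', heq, hne'⟩ := h1
    exact mem_biUnion.2 ⟨(f, f'), mem_offDiag.2 ⟨hf, hf', hne'⟩, mem_filter.2 ⟨hpP, heq⟩⟩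
  have h1 : ∀ z ∈ F.offDiag, ((P.filter fun p => z.1 % p = z.2 % p).card : ℝ) * Real.log 2 ≤
      Real.log N := by
    intro z hz
    rw [mem_offDiag] at hz
    refine le_trans ?_ (sum_log_primes_dvd_sub_le P hP N _ _ (hF hz.1) (hF hz.2.1) hz.2.2)
    rw [← nsmul_eq_mul]
    refine card_nsmul_le_sum _ _ _ fun p hp => ?_
    exact Real.log_le_log two_pos (by exact_mod_cast (hP p (mem_filter.1 hp).1).two_le)
  have h2 : ((P.filter fun p => (residues F p).card ≠ F.card).card : ℝ) ≤
      ∑ z ∈ F.offDiag, ((P.filter fun p => z.1 % p = z.2 % p).card : ℝ) := by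
    exact_mod_cast (card_le_card hsub).trans card_biUnion_le
  have h3 := sum_le_sum h1
  rw [← sum_mul, sum_const, nsmul_eq_mul] at h3
  have h4 : (F.offDiag.card : ℝ) ≤ (F.card : ℝ) ^ 2 := by
    rw [offDiag_card, sq]
    exact_mod_cast Nat.sub_le _ _
  calc _ ≤ (∑ z ∈ F.offDiag, ((P.filter fun p => z.1 % p = z.2 % p).card : ℝ)) * Real.log 2 :=
        mul_le_mul_of_nonneg_right h2 (Real.log_nonneg one_le_two)
    _ ≤ F.offDiag.card * Real.log N := h3
    _ ≤ _ := mul_le_mul_of_nonneg_right h4 (Real.log_natCast_nonneg N)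

/-- The primes modulo which two members of `F` collide divide nonzero differences, so there are
few of them and the sum of their reciprocals is small. -/
lemma sum_inv_filter_card_residues_ne_le (P : Finset ℕ) (hP : ∀ p ∈ P, p.Prime) (N : ℕ)
    (F : Finset ℕ) (hF : F ⊆ Icc 1 N) (t : ℝ) (ht : 0 < t) :
    ∑ p ∈ P with (residues F p).card ≠ F.card, 1 / (p : ℝ) ≤
      ∑ p ∈ ⌊t⌋₊.primesLE, 1 / (p : ℝ) + (F.card : ℝ) ^ 2 * Real.log N / Real.log 2 / t := by
  set Q := P.filter fun p => (residues F p).card ≠ F.card with hQ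
  have hl2 : 0 < Real.log 2 := Real.log_pos one_lt_two
  rw [← sum_filter_add_sum_filter_not Q (fun p : ℕ => (p : ℝ) ≤ t)]
  refine add_le_add ?_ ?_
  · refine sum_le_sum_of_subset_of_nonneg (fun p hp => ?_) fun p _ _ => by positivity
    obtain ⟨h1, h2⟩ := mem_filter.1 hp
    exact Nat.mem_primesLE.2 ⟨Nat.le_floor h2, hP p (mem_filter.1 h1).1⟩
  · have h1 : ∀ p ∈ Q.filter (fun p : ℕ => ¬ (p : ℝ) ≤ t), 1 / (p : ℝ) ≤ 1 / t := fun p hp =>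
      one_div_le_one_div_of_le ht (not_le.1 (mem_filter.1 hp).2).le
    refine (sum_le_card_nsmul _ _ _ h1).trans ?_
    rw [nsmul_eq_mul, mul_one_div]
    refine div_le_div_of_nonneg_right ?_ ht.le
    rw [le_div_iff₀ hl2]
    refine le_trans (mul_le_mul_of_nonneg_right ?_ hl2.le)
      (card_filter_card_residues_ne_mul_le P hP N F hF)
    exact_mod_cast card_filter_le _ _

lemma exp_neg_two_mul_le_one_sub {t : ℝ} (h0 : 0 ≤ t) (h1 : t ≤ 1 / 2) :
    Real.exp (-(2 * t)) ≤ 1 - t := by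
  rw [Real.exp_neg, inv_le_comm₀ (Real.exp_pos _) (by linarith)]
  refine le_trans ?_ (Real.add_one_le_exp (2 * t))
  rw [inv_le_iff_one_le_mul₀ (by linarith)]
  nlinarith

/-- Comparison of the sieve product with the `k`-th power of the Euler product, where
`k = |F|`; the primes modulo which `F` has fewer than `k` classes cost an exponential factor. -/
lemma log_pow_mul_exp_le_prod (z : ℕ) (F : Finset ℕ)
    (hlt : ∀ p ∈ z.primesLE, (residues F p).card < p) :
    Real.log (z + 1) ^ F.card * Real.exp (-(2 * F.card *
      ∑ p ∈ z.primesLE with (residues F p).card ≠ F.card, 1 / (p : ℝ))) ≤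
      ∏ p ∈ z.primesLE, (1 + ((residues F p).card : ℝ) / (p - (residues F p).card)) := by
  set k := F.card with hk
  have hp2 : ∀ p ∈ z.primesLE, (2 : ℝ) ≤ p := fun p hp => by
    exact_mod_cast Nat.two_le_of_mem_primesLE hp
  have hinv : ∀ p ∈ z.primesLE, 1 / (p : ℝ) ≤ 1 / 2 := fun p hp =>
    one_div_le_one_div_of_le two_pos (hp2 p hp)
  have hexp : Real.exp (-(2 * k *
      ∑ p ∈ z.primesLE with (residues F p).card ≠ k, 1 / (p : ℝ))) =
      ∏ p ∈ z.primesLE, if (residues F p).card ≠ k then Real.exp (-(2 * (1 / (p : ℝ)))) ^ k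
        else 1 := by
    rw [← prod_filter]
    simp only [← Real.exp_nat_mul]
    rw [← Real.exp_sum, ← mul_sum]
    congr 1
    rw [sum_neg_distrib, ← mul_sum]
    ring
  have hlog : Real.log (z + 1) ^ k ≤ ∏ p ∈ z.primesLE, ((1 - 1 / (p : ℝ))⁻¹) ^ k := by
    rw [prod_pow]
    refine pow_le_pow_left₀ (Real.log_nonneg (by linarith [(Nat.cast_nonneg z : (0 : ℝ) ≤ z)]))
      (log_le_prod_primesLE z) k
  rw [hexp]
  refine (mul_le_mul_of_nonneg_right hlog (prod_nonneg fun p _ => ?_)).trans ?_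
  · split_ifs <;> positivity
  rw [← prod_mul_distrib]
  refine prod_le_prod (fun p hp => ?_) fun p hp => ?_
  · have := hinv p hp
    have h1 : 0 ≤ (1 - 1 / (p : ℝ))⁻¹ := inv_nonneg.2 (by linarith)
    split_ifs <;> positivity
  have hpos : 0 < 1 - 1 / (p : ℝ) := by linarith [hinv p hp]
  have hνp : ((residues F p).card : ℝ) < p := by exact_mod_cast hlt p hp
  have hp0 : (0 : ℝ) < p := by linarith [hp2 p hp]
  split_ifs with h
  · have h1 := exp_neg_two_mul_le_one_sub (by positivity) (hinv p hp)
    have h2 : Real.exp (-(2 * (1 / (p : ℝ)))) ^ k ≤ (1 - 1 / (p : ℝ)) ^ k :=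
      pow_le_pow_left₀ (Real.exp_pos _).le h1 k
    have h3 : 0 ≤ ((residues F p).card : ℝ) / (p - (residues F p).card) :=
      div_nonneg (Nat.cast_nonneg _) (by linarith)
    calc ((1 - 1 / (p : ℝ))⁻¹) ^ k * Real.exp (-(2 * (1 / (p : ℝ)))) ^ k
        ≤ ((1 - 1 / (p : ℝ))⁻¹) ^ k * (1 - 1 / (p : ℝ)) ^ k :=
          mul_le_mul_of_nonneg_left h2 (pow_nonneg (inv_nonneg.2 hpos.le) k)
      _ = 1 := by rw [← mul_pow, inv_mul_cancel₀ hpos.ne', one_pow]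
      _ ≤ _ := by linarith
  · rw [not_not] at h
    rw [h] at hνp ⊢
    have hb := one_add_mul_le_pow (a := -(1 / (p : ℝ))) (by linarith) k
    have h1 : 1 + (k : ℝ) / (p - k) = (1 + k * -(1 / (p : ℝ)))⁻¹ := by
      have hpk : (p : ℝ) - k ≠ 0 := (sub_pos.2 hνp).ne'
      have h3 : 1 + k * -(1 / (p : ℝ)) = (p - k) / p := by field_simp; ring
      rw [h3, inv_div, eq_div_iff hpk, add_mul, div_mul_cancel₀ _ hpk]
      ring
    have h2 : 0 < 1 + k * -(1 / (p : ℝ)) := by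
      have : (k : ℝ) / p < 1 := (div_lt_one hp0).2 hνp
      rw [mul_neg, mul_one_div]; linarith
    rw [mul_one, h1, inv_pow]
    exact inv_anti₀ h2 (by rw [← sub_eq_add_neg] at hb; exact hb)

/-- The sieve with at most `J` primes, each at most `z`. -/
lemma card_mul_log_pow_le (F G : Finset ℕ) (N z J : ℕ) (hz : 1 ≤ z) (hzJ : z ^ (2 * J) ≤ N)
    (hJ1 : 1 ≤ J) (hJ : 2 * (F.card * ∑ p ∈ z.primesLE, 1 / (p : ℝ)) ≤ J) (hF : F.Nonempty)
    (hG : G ⊆ Icc 1 N)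
    (hFG : ∀ f ∈ F, ∀ g ∈ G, ∀ p : ℕ, p.Prime → p ^ 2 ≤ N → ¬ p ∣ g + f) :
    (G.card : ℝ) * (Real.log (z + 1) ^ F.card * Real.exp (-(2 * F.card *
      ∑ p ∈ z.primesLE with (residues F p).card ≠ F.card, 1 / (p : ℝ)))) ≤ 10 * N := by
  rcases G.eq_empty_or_nonempty with rfl | ⟨g₀, hg₀⟩
  · simp
  have hN : 0 < N := lt_of_lt_of_le (by positivity) hzJ
  have hlt : ∀ p ∈ z.primesLE, (residues F p).card < p := fun p hp =>
    card_residues_lt (Nat.prime_of_mem_primesLE hp).pos fun f hf =>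
      hFG f hf g₀ hg₀ p (Nat.prime_of_mem_primesLE hp)
        (((Nat.pow_le_pow_left (Nat.le_of_mem_primesLE hp) 2).trans
          (Nat.pow_le_pow_right (by omega) (by omega))).trans hzJ)
  set w : ℕ → ℝ := fun p => ((residues F p).card : ℝ) / (p - (residues F p).card) with hw
  have hpos : ∀ p ∈ z.primesLE, (0 : ℝ) < p - (residues F p).card := fun p hp => by
    rw [sub_pos]; exact_mod_cast hlt p hp
  have hp0 : ∀ p ∈ z.primesLE, (0 : ℝ) < p := fun p hp => by
    exact_mod_cast (Nat.prime_of_mem_primesLE hp).pos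
  have hw0 : ∀ p ∈ z.primesLE, 0 ≤ w p := fun p hp =>
    div_nonneg (Nat.cast_nonneg _) (hpos p hp).le
  have hmean : 2 * ∑ p ∈ z.primesLE, w p / (1 + w p) ≤ J := by
    refine le_trans ?_ hJ
    refine mul_le_mul_of_nonneg_left ?_ two_pos.le
    rw [mul_sum]
    refine sum_le_sum fun p hp => ?_
    have h1 : w p / (1 + w p) = ((residues F p).card : ℝ) / p := by
      have h2 := (hpos p hp).ne'
      have h3 := (hp0 p hp).ne'
      have h4 : 1 + w p = p / (p - (residues F p).card) := by
        simp only [hw]; field_simp; ring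
      rw [h4]
      simp only [hw]
      field_simp
    rw [h1, mul_one_div]
    exact div_le_div_of_nonneg_right (by exact_mod_cast card_image_le) (hp0 p hp).le
  have hhalf := half_prod_le_sum_powerset_card_le z.primesLE w hw0 J hmean
  have hmem : ∀ S ∈ z.primesLE.powerset.filter (fun S => S.card ≤ J), S ⊆ z.primesLE := fun S hS =>
    mem_powerset.1 (mem_filter.1 hS).1
  have hsieve := card_mul_sum_prod_residues_le (z.primesLE.powerset.filter fun S => S.card ≤ J)
    (fun S hS p hp => Nat.prime_of_mem_primesLE (hmem S hS hp)) N hN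
    (fun S hS => by
      have h3 : ∏ p ∈ S, p ≤ z ^ J :=
        (prod_le_pow_card _ _ _ fun p hp => Nat.le_of_mem_primesLE (hmem S hS hp)).trans
          (Nat.pow_le_pow_right hz (mem_filter.1 hS).2)
      calc (∏ p ∈ S, p) ^ 2 ≤ (z ^ J) ^ 2 := Nat.pow_le_pow_left h3 2
        _ = z ^ (2 * J) := by rw [← pow_mul, mul_comm]
        _ ≤ N := hzJ) F G hF hG hFG
  have hprod := log_pow_mul_exp_le_prod z F hlt
  have h1 := mul_le_mul_of_nonneg_left (hprod.trans (by linarith [hhalf] :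
    _ ≤ 2 * ∑ S ∈ z.primesLE.powerset with S.card ≤ J, ∏ p ∈ S, w p))
    (Nat.cast_nonneg (α := ℝ) G.card)
  linarith

/-- If `F` has at least `k` elements, then `G` has at most `x / (log x)^{k - ε}` elements. -/
lemma eventually_card_le_div_log_rpow (k : ℕ) (hk : 1 ≤ k) (ε : ℝ) (hε : 0 < ε) :
    ∀ᶠ x : ℝ in atTop, ∀ F G : Finset ℕ, F ⊆ Icc 1 ⌊x⌋₊ → G ⊆ Icc 1 ⌊x⌋₊ → k ≤ F.card →
      (∀ f ∈ F, ∀ g ∈ G, ∀ p : ℕ, p.Prime → p ^ 2 ≤ ⌊x⌋₊ → ¬ p ∣ g + f) →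
      (G.card : ℝ) ≤ x / Real.log x ^ ((k : ℝ) - ε) := by
  set η : ℝ := ε / (k + 2) with hη
  have hk2 : (0 : ℝ) < k + 2 := by positivity
  have hη0 : 0 < η := by positivity
  have hk0 : (0 : ℝ) < k := by exact_mod_cast hk
  have hl2 : 1 / 2 < Real.log 2 := by linarith [Real.log_two_gt_d9]
  have e1 := eventually_sum_inv_primesLE_le_rpow (η / 2) (by positivity)
  have e2 := Real.tendsto_log_atTop.eventually
    (eventually_sum_inv_primesLE_le_rpow (1 / 2) (by norm_num))
  have e3 := ((tendsto_rpow_atTop (half_pos hη0)).comp Real.tendsto_log_atTop).eventually_ge_atTop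
    (2 * k : ℝ)
  have e4 : ∀ᶠ s : ℝ in atTop, 2 * k * (s ^ (1 / 2 : ℝ) + 2 * k ^ 2) ≤ η * s := by
    have h1 : (fun s : ℝ => 2 * k * (s ^ (1 / 2 : ℝ) + 2 * k ^ 2)) =o[atTop] (fun s => s) := by
      refine Asymptotics.IsLittleO.const_mul_left (Asymptotics.IsLittleO.add ?_ ?_) _
      · refine (Asymptotics.isLittleO_of_tendsto' ?_ ?_)
        · filter_upwards [eventually_gt_atTop 0] with s hs h0
          exact absurd h0 hs.ne'
        · refine (tendsto_rpow_neg_atTop (y := 1 / 2) (by norm_num)).congr' ?_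
          filter_upwards [eventually_gt_atTop 0] with s hs
          rw [eq_div_iff hs.ne', ← Real.rpow_add_one hs.ne']
          norm_num
      · exact Asymptotics.isLittleO_const_id_atTop _
    filter_upwards [h1.bound hη0, eventually_ge_atTop 0] with s hs hs0
    rw [Real.norm_of_nonneg hs0] at hs
    exact (le_abs_self _).trans hs
  have e5 := (Real.tendsto_log_atTop.comp Real.tendsto_log_atTop).eventually e4
  have e6 := ((tendsto_rpow_atTop hη0).comp Real.tendsto_log_atTop).eventually_ge_atTop
    (10 * 4 ^ k : ℝ)
  filter_upwards [e1, e2, e3, e5, e6, Real.tendsto_log_atTop.eventually_ge_atTop 1,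
    eventually_ge_atTop 1] with x h1 h2 h3 h5 h6 hl1 hx1
  intro F G hF hG hkF hFG
  simp only [Function.comp] at h3 h5 h6
  set ℓ := Real.log x with hℓ
  set N := ⌊x⌋₊ with hN
  have hℓ0 : 0 < ℓ := by linarith
  have hx0 : 0 < x := by linarith
  have hNx : (N : ℝ) ≤ x := Nat.floor_le hx0.le
  have hN1 : 1 ≤ N := Nat.le_floor (by exact_mod_cast hx1)
  obtain ⟨F', hF'F, hF'k⟩ := exists_subset_card_eq hkF
  have hF'ne : F'.Nonempty := card_pos.1 (by omega)
  -- a power of `log x` exceeds twice the mean `∑ ν_p / p = O(log log x)` for large `x`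
  set J := ⌈ℓ ^ η⌉₊ with hJ
  have hℓη : 1 ≤ ℓ ^ η := Real.one_le_rpow hl1 hη0.le
  have hJ1 : 1 ≤ J := Nat.one_le_ceil_iff.2 (by linarith)
  have hJle : (J : ℝ) ≤ 2 * ℓ ^ η := by
    have := Nat.ceil_lt_add_one (by linarith : 0 ≤ ℓ ^ η)
    linarith
  have hJ0 : (0 : ℝ) < J := by exact_mod_cast hJ1
  set z := ⌊x ^ (1 / (2 * J : ℝ))⌋₊ with hz
  have hz1 : 1 ≤ z := Nat.le_floor (by
    rw [Nat.cast_one]; exact Real.one_le_rpow hx1 (by positivity))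
  have hzJ : z ^ (2 * J) ≤ N := by
    refine Nat.le_floor ?_
    push_cast
    calc (z : ℝ) ^ (2 * J) ≤ (x ^ (1 / (2 * J : ℝ))) ^ (2 * J) :=
          pow_le_pow_left₀ (Nat.cast_nonneg _) (Nat.floor_le (by positivity)) _
      _ = x := by
          rw [← Real.rpow_natCast, ← Real.rpow_mul hx0.le]
          push_cast
          rw [one_div_mul_cancel (by positivity), Real.rpow_one]
  have hzN : z ≤ N := (Nat.le_self_pow (by omega) z).trans hzJ
  have hlogz : ℓ / (2 * J) ≤ Real.log (z + 1) := by
    have h7 : x ^ (1 / (2 * J : ℝ)) ≤ z + 1 := (Nat.lt_floor_add_one _).le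
    have h8 := Real.log_le_log (Real.rpow_pos_of_pos hx0 _) h7
    rw [Real.log_rpow hx0] at h8
    rw [div_eq_mul_one_div, mul_comm]
    exact h8
  have hmean : 2 * (F'.card * ∑ p ∈ z.primesLE, 1 / (p : ℝ)) ≤ J := by
    have h7 : ∑ p ∈ z.primesLE, 1 / (p : ℝ) ≤ ℓ ^ (η / 2) :=
      (sum_le_sum_of_subset_of_nonneg (Nat.primesLE_mono hzN) fun p _ _ => by positivity).trans h1
    have h8 : ℓ ^ η = ℓ ^ (η / 2) * ℓ ^ (η / 2) := by
      rw [← Real.rpow_add hℓ0]; congr 1; ring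
    have h9 : 0 ≤ ℓ ^ (η / 2) := by positivity
    rw [hF'k]
    calc 2 * (k * ∑ p ∈ z.primesLE, 1 / (p : ℝ)) ≤ 2 * (k * ℓ ^ (η / 2)) :=
          mul_le_mul_of_nonneg_left (mul_le_mul_of_nonneg_left h7 hk0.le) two_pos.le
      _ = (2 * k) * ℓ ^ (η / 2) := by ring
      _ ≤ ℓ ^ (η / 2) * ℓ ^ (η / 2) := mul_le_mul_of_nonneg_right h3 h9
      _ ≤ J := by rw [← h8]; exact Nat.le_ceil _
  have hmain := card_mul_log_pow_le F' G N z J hz1 hzJ hJ1 hmean hF'ne hG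
    fun f hf => hFG f (hF'F hf)
  rw [hF'k] at hmain
  -- splitting the exceptional primes at `log x`, of which there are only `O(log x)`
  have hbad : ∑ p ∈ z.primesLE with (residues F' p).card ≠ k, 1 / (p : ℝ) ≤
      Real.log ℓ ^ (1 / 2 : ℝ) + 2 * k ^ 2 := by
    have h7 := sum_inv_filter_card_residues_ne_le z.primesLE
      (fun p hp => Nat.prime_of_mem_primesLE hp) N F' (hF'F.trans hF) ℓ hℓ0
    rw [hF'k] at h7
    refine h7.trans (add_le_add h2 ?_)
    have h8 : Real.log N ≤ ℓ := Real.log_le_log (by exact_mod_cast hN1) hNx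
    rw [div_div, div_le_iff₀ (by positivity)]
    calc (k : ℝ) ^ 2 * Real.log N ≤ k ^ 2 * ℓ := mul_le_mul_of_nonneg_left h8 (by positivity)
      _ ≤ k ^ 2 * ℓ * (2 * Real.log 2) := le_mul_of_one_le_right (by positivity) (by linarith)
      _ = _ := by ring
  have hexp : ℓ ^ (-η) ≤ Real.exp (-(2 * k *
      ∑ p ∈ z.primesLE with (residues F' p).card ≠ k, 1 / (p : ℝ))) := by
    rw [Real.rpow_def_of_pos hℓ0]
    apply Real.exp_le_exp.2
    have h7 := mul_le_mul_of_nonneg_left hbad (by positivity : 0 ≤ 2 * (k : ℝ))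
    linarith
  have hpow : (ℓ ^ (1 - η) / 4) ^ k ≤ Real.log (z + 1) ^ k := by
    refine pow_le_pow_left₀ (by positivity) (le_trans ?_ hlogz) k
    rw [Real.rpow_sub hℓ0, Real.rpow_one, div_div]
    exact div_le_div_of_nonneg_left hℓ0.le (by positivity) (by linarith)
  have hL : 10 * ℓ ^ ((k : ℝ) - ε) ≤ Real.log (z + 1) ^ k * Real.exp (-(2 * k *
      ∑ p ∈ z.primesLE with (residues F' p).card ≠ k, 1 / (p : ℝ))) := by
    refine le_trans ?_ (mul_le_mul hpow hexp (by positivity)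
      (pow_nonneg (Real.log_nonneg (by linarith [(Nat.cast_nonneg z : (0 : ℝ) ≤ z)])) k))
    rw [div_pow, ← Real.rpow_natCast (ℓ ^ (1 - η)), ← Real.rpow_mul hℓ0.le, div_mul_eq_mul_div,
      ← Real.rpow_add hℓ0, le_div_iff₀ (by positivity)]
    have h7 : (1 - η) * k + -η = ((k : ℝ) - ε) + η := by
      have : η * (k + 2) = ε := by rw [hη]; field_simp
      linarith
    rw [h7, Real.rpow_add hℓ0]
    calc 10 * ℓ ^ ((k : ℝ) - ε) * 4 ^ k = ℓ ^ ((k : ℝ) - ε) * (10 * 4 ^ k) := by ring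
      _ ≤ _ := mul_le_mul_of_nonneg_left h6 (by positivity)
  rw [le_div_iff₀ (by positivity)]
  have h7 := mul_le_mul_of_nonneg_left hL (Nat.cast_nonneg (α := ℝ) G.card)
  linarith

end BoundedShifts

/-! ### Combination of the sieves -/

section Combination

open Finset Filter

lemma mul_log_rpow_le_card {c δ a x n g : ℝ} (hc : 0 < c) (hx : 0 < x) (hl : 0 < Real.log x)
    (hn : 0 ≤ n) (hprod : c * (x / Real.log x ^ δ) ≤ n * g) (hg : g ≤ x / Real.log x ^ a) :
    c * Real.log x ^ (a - δ) ≤ n := by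
  have h1 : c * (x / Real.log x ^ δ) ≤ n * (x / Real.log x ^ a) :=
    hprod.trans (mul_le_mul_of_nonneg_left hg hn)
  have ha : 0 < Real.log x ^ a := Real.rpow_pos_of_pos hl a
  have hd : 0 < Real.log x ^ δ := Real.rpow_pos_of_pos hl δ
  have h2 := mul_le_mul_of_nonneg_right h1 (div_pos ha hx).le
  rw [Real.rpow_sub hl]
  have h3 : n * (x / Real.log x ^ a) * (Real.log x ^ a / x) = n := by field_simp
  have h4 : c * (x / Real.log x ^ δ) * (Real.log x ^ a / x) =
      c * (Real.log x ^ a / Real.log x ^ δ) := by field_simp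
  linarith

/-- Two applications of the sieve by boundedly many shifts: more than `δ` elements in `F` force
arbitrarily many, and hence `|F| ≥ (log x)^6`. -/
lemma eventually_log_pow_six_le_card (δ : ℝ) (hδ : 0 ≤ δ) (c : ℝ) (hc : 0 < c) :
    ∀ᶠ x : ℝ in atTop, ∀ F G : Finset ℕ, F ⊆ Icc 1 ⌊x⌋₊ → G ⊆ Icc 1 ⌊x⌋₊ → δ < F.card →
      (∀ f ∈ F, ∀ g ∈ G, ∀ p : ℕ, p.Prime → p ^ 2 ≤ ⌊x⌋₊ → ¬ p ∣ g + f) →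
      c * (x / Real.log x ^ δ) ≤ (F.card : ℝ) * G.card → Real.log x ^ 6 ≤ F.card := by
  set k₁ := ⌊δ⌋₊ + 1 with hk₁
  have hk₁δ : 0 < ((k₁ : ℝ) - δ) / 2 := by
    have := Nat.lt_floor_add_one δ
    rw [hk₁]; push_cast; linarith
  set k₂ := ⌈δ⌉₊ + 8 with hk₂
  have hk₂δ : (8 : ℝ) + δ ≤ k₂ := by
    have := Nat.le_ceil δ
    rw [hk₂]; push_cast; linarith
  filter_upwards [eventually_card_le_div_log_rpow k₁ (by omega) _ hk₁δ,
    eventually_card_le_div_log_rpow k₂ (by omega) 1 one_pos,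
    ((tendsto_rpow_atTop hk₁δ).comp Real.tendsto_log_atTop).eventually_ge_atTop (k₂ / c),
    Real.tendsto_log_atTop.eventually_ge_atTop (1 / c),
    Real.tendsto_log_atTop.eventually_ge_atTop 1, eventually_gt_atTop 0]
    with x h1 h2 h3 h4 hl hx
  intro F G hF hG hFδ hFG hprod
  have hl0 : 0 < Real.log x := by linarith
  have hF1 : k₁ ≤ F.card := Nat.succ_le_of_lt ((Nat.floor_lt hδ).2 hFδ)
  have hF2 : k₂ ≤ F.card := by
    have h5 := mul_log_rpow_le_card hc hx hl0 (Nat.cast_nonneg _) hprod (h1 F G hF hG hF1 hFG)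
    have h6 : (k₁ : ℝ) - ((k₁ : ℝ) - δ) / 2 - δ = ((k₁ : ℝ) - δ) / 2 := by ring
    rw [h6] at h5
    simp only [Function.comp] at h3
    rw [div_le_iff₀ hc] at h3
    have h7 : (k₂ : ℝ) ≤ F.card := by linarith
    exact_mod_cast h7
  have h5 := mul_log_rpow_le_card hc hx hl0 (Nat.cast_nonneg _) hprod (h2 F G hF hG hF2 hFG)
  refine le_trans ?_ h5
  have h6 : Real.log x ^ (7 : ℝ) ≤ Real.log x ^ ((k₂ : ℝ) - 1 - δ) :=
    Real.rpow_le_rpow_of_exponent_le hl (by linarith)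
  rw [div_le_iff₀ hc] at h4
  calc Real.log x ^ 6 ≤ Real.log x ^ 6 * (Real.log x * c) :=
        le_mul_of_one_le_right (by positivity) h4
    _ = c * Real.log x ^ (7 : ℝ) := by
        rw [show (7 : ℝ) = ((7 : ℕ) : ℝ) by norm_num, Real.rpow_natCast]; ring
    _ ≤ _ := mul_le_mul_of_nonneg_left h6 hc.le

/-- With `n^{2m} ≤ x < n^{2m+2}` and `m ≥ 3`, a bound `g ≤ 5x / n^{m/2}` saves a power of `x` in
the product `n g`. -/
lemma mul_mul_rpow_le {x n g : ℝ} {m : ℕ} (hx : 0 < x) (hn : 1 ≤ n) (hg : 0 ≤ g) (hm : 3 ≤ m)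
    (hxn : x ≤ n ^ (2 * (m + 1))) (h : g * √n ^ m ≤ 5 * x) :
    n * g * x ^ (1 / 16 : ℝ) ≤ 5 * x := by
  have hn0 : 0 < n := by linarith
  have h1 : x ^ (1 / 16 : ℝ) ≤ n ^ ((m + 1 : ℝ) / 8) := by
    calc x ^ (1 / 16 : ℝ) ≤ (n ^ (2 * (m + 1))) ^ (1 / 16 : ℝ) :=
          Real.rpow_le_rpow hx.le hxn (by norm_num)
      _ = n ^ ((m + 1 : ℝ) / 8) := by
          rw [← Real.rpow_natCast, ← Real.rpow_mul hn0.le]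
          congr 1; push_cast; ring
  have h2 : √n ^ m = n ^ ((m : ℝ) / 2) := by
    rw [Real.sqrt_eq_rpow, ← Real.rpow_natCast, ← Real.rpow_mul hn0.le]
    congr 1; ring
  have hm' : (3 : ℝ) ≤ m := by exact_mod_cast hm
  have h3 : n * n ^ ((m + 1 : ℝ) / 8) ≤ n ^ ((m : ℝ) / 2) := by
    nth_rewrite 1 [← Real.rpow_one n]
    rw [← Real.rpow_add hn0]
    exact Real.rpow_le_rpow_of_exponent_le hn (by linarith)
  calc n * g * x ^ (1 / 16 : ℝ) ≤ n * g * n ^ ((m + 1 : ℝ) / 8) :=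
        mul_le_mul_of_nonneg_left h1 (by positivity)
    _ = g * (n * n ^ ((m + 1 : ℝ) / 8)) := by ring
    _ ≤ g * n ^ ((m : ℝ) / 2) := mul_le_mul_of_nonneg_left h3 hg
    _ ≤ 5 * x := by rw [← h2]; exact h

/-- The upper bound for `G`. If `(log x)^6 ≤ |F| < x^{1/6}`, products of `m ≥ 3` primes up to
`|F|` in the large sieve make `|F| |G|` too small; otherwise products of three primes up to
`x^{1/6}` give the bound. -/
lemma exists_eventually_card_le_sqrt_mul_log (δ : ℝ) (hδ : 0 ≤ δ) (c : ℝ) (hc : 0 < c) :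
    ∃ C : ℝ, 0 < C ∧ ∀ᶠ x : ℝ in atTop, ∀ F G : Finset ℕ, F ⊆ Icc 1 ⌊x⌋₊ → G ⊆ Icc 1 ⌊x⌋₊ →
      δ < F.card →
      (∀ f ∈ F, ∀ g ∈ G, ∀ p : ℕ, p.Prime → p ^ 2 ≤ ⌊x⌋₊ → ¬ p ∣ g + f) →
      c * (x / Real.log x ^ δ) ≤ (F.card : ℝ) * G.card →
      (G.card : ℝ) ≤ C * (√x * Real.log x ^ 6) := by
  obtain ⟨κ, hκ, hsieve⟩ := exists_card_mul_pow_le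
  refine ⟨40 / κ ^ 3, by positivity, ?_⟩
  have e1 : ∀ᶠ x : ℝ in atTop, 5 * Real.log x ^ δ < c * x ^ (1 / 16 : ℝ) := by
    have h1 := (isLittleO_log_rpow_rpow_atTop (s := 1 / 16) δ (by norm_num)).bound
      (c := c / 10) (by positivity)
    filter_upwards [h1, eventually_gt_atTop 0] with x hx hx0
    rw [Real.norm_of_nonneg (by positivity : 0 ≤ x ^ (1 / 16 : ℝ))] at hx
    have h2 := (le_abs_self _).trans hx
    have h3 : 0 < c * x ^ (1 / 16 : ℝ) := by positivity
    linarith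
  have e2 : ∀ᶠ x : ℝ in atTop, Real.log x ^ 2 ≤ κ / 2 * x ^ (1 / 6 : ℝ) := by
    have h1 := (isLittleO_log_rpow_rpow_atTop (s := 1 / 6) 2 (by norm_num)).bound
      (c := κ / 2) (by positivity)
    filter_upwards [h1, eventually_gt_atTop 0] with x hx hx0
    rw [Real.norm_of_nonneg (by positivity : 0 ≤ x ^ (1 / 6 : ℝ)),
      show (2 : ℝ) = ((2 : ℕ) : ℝ) by norm_num, Real.rpow_natCast] at hx
    exact_mod_cast (le_abs_self _).trans hx
  filter_upwards [eventually_log_pow_six_le_card δ hδ c hc, e1, e2,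
    (tendsto_rpow_atTop (by norm_num : (0 : ℝ) < 1 / 6)).eventually_ge_atTop 2,
    Real.tendsto_log_atTop.eventually_ge_atTop (1 / κ),
    Real.tendsto_log_atTop.eventually_ge_atTop 2, eventually_ge_atTop 3]
    with x hsix h1 h2 h3 h4 hl hx
  intro F G hF hG hFδ hFG hprod
  have hlarge := hsix F G hF hG hFδ hFG hprod
  have hl0 : 0 < Real.log x := by linarith
  have hx0 : 0 < x := by linarith
  set n := F.card with hn
  have hn64 : (64 : ℝ) ≤ n := by
    refine le_trans ?_ hlarge
    calc (64 : ℝ) = 2 ^ 6 := by norm_num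
      _ ≤ _ := pow_le_pow_left₀ two_pos.le hl 6
  have hn2 : 2 ≤ n := by
    have : (2 : ℝ) ≤ n := by linarith
    exact_mod_cast this
  have hFne : F.Nonempty := card_pos.1 (by omega)
  set y := ⌊x ^ (1 / 6 : ℝ)⌋₊ with hy
  have hy2 : 2 ≤ y := Nat.le_floor (by exact_mod_cast h3)
  have hy6 : y ^ (2 * 3) ≤ ⌊x⌋₊ := by
    refine Nat.le_floor ?_
    push_cast
    calc (y : ℝ) ^ (2 * 3) ≤ (x ^ (1 / 6 : ℝ)) ^ (2 * 3) :=
          pow_le_pow_left₀ (Nat.cast_nonneg _) (Nat.floor_le (by positivity)) _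
      _ = x := by
          rw [← Real.rpow_natCast, ← Real.rpow_mul hx0.le]
          norm_num
  have hnlog : (n : ℝ) ≤ n * Real.log x := le_mul_of_one_le_right (Nat.cast_nonneg _) (by linarith)
  rcases le_total y n with hyn | hyn
  · have hyhalf : x ^ (1 / 6 : ℝ) / 2 ≤ y := by
      have h5 := Nat.lt_floor_add_one (x ^ (1 / 6 : ℝ))
      have h6 : (2 : ℝ) ≤ y := by exact_mod_cast hy2
      rw [← hy] at h5
      linarith
    have hV : κ * (x ^ (1 / 6 : ℝ) / 2) / Real.log x ^ 2 ≤ κ * y / Real.log x ^ 2 :=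
      div_le_div_of_nonneg_right (mul_le_mul_of_nonneg_left hyhalf hκ.le) (by positivity)
    have hV1 : 1 ≤ κ * (x ^ (1 / 6 : ℝ) / 2) / Real.log x ^ 2 := by
      rw [one_le_div (by positivity)]
      linarith
    have h5 := hsieve x hx y 3 hy2 (by norm_num) hy6 F G hF hG hFne hFG
      (le_trans (by exact_mod_cast hyn) hnlog) (hV1.trans hV)
    have h6 : (G.card : ℝ) * (κ * (x ^ (1 / 6 : ℝ) / 2) / Real.log x ^ 2) ^ 3 ≤ 5 * x :=
      (mul_le_mul_of_nonneg_left (pow_le_pow_left₀ (by linarith) hV 3)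
        (Nat.cast_nonneg _)).trans h5
    have h7 : (x ^ (1 / 6 : ℝ)) ^ 3 = √x := by
      rw [← Real.rpow_natCast, ← Real.rpow_mul hx0.le, Real.sqrt_eq_rpow]
      norm_num
    have h8 : (κ * (x ^ (1 / 6 : ℝ) / 2) / Real.log x ^ 2) ^ 3 =
        κ ^ 3 * √x / (8 * Real.log x ^ 6) := by
      rw [← h7]; field_simp; ring
    have hs : 0 < √x := Real.sqrt_pos.2 hx0
    rw [h8, mul_div_assoc', div_le_iff₀ (by positivity)] at h6
    have h9 : (κ ^ 3 * √x) * G.card ≤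
        (κ ^ 3 * √x) * (40 / κ ^ 3 * (√x * Real.log x ^ 6)) := by
      have h10 : (κ ^ 3 * √x) * (40 / κ ^ 3 * (√x * Real.log x ^ 6)) =
          40 * (√x * √x) * Real.log x ^ 6 := by field_simp
      rw [h10, Real.mul_self_sqrt hx0.le]
      linarith
    exact le_of_mul_le_mul_left h9 (by positivity)
  · exfalso
    set m := Nat.log (n ^ 2) ⌊x⌋₊ with hm
    have hn21 : 1 < n ^ 2 := Nat.one_lt_pow two_ne_zero (by omega)
    have hN0 : ⌊x⌋₊ ≠ 0 := by
      have : 3 ≤ ⌊x⌋₊ := Nat.le_floor (by exact_mod_cast hx)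
      omega
    have hm3 : 3 ≤ m := by
      refine Nat.le_log_of_pow_le hn21 ?_
      rw [← pow_mul]
      exact (Nat.pow_le_pow_left hyn _).trans hy6
    have hm1 : n ^ (2 * m) ≤ ⌊x⌋₊ := by
      rw [pow_mul]; exact Nat.pow_log_le_self _ hN0
    have hm2 : x ≤ (n : ℝ) ^ (2 * (m + 1)) := by
      have h5 : ⌊x⌋₊ < (n ^ 2) ^ (m + 1) := Nat.lt_pow_succ_log_self hn21 _
      rw [← pow_mul] at h5
      have h6 := (Nat.floor_lt hx0.le).1 h5
      push_cast at h6
      exact h6.le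
    have hsq : Real.log x ^ 3 ≤ √n := by
      refine Real.le_sqrt_of_sq_le ?_
      rw [← pow_mul]; exact hlarge
    have hV : √n ≤ κ * n / Real.log x ^ 2 := by
      rw [le_div_iff₀ (by positivity)]
      rw [div_le_iff₀ hκ] at h4
      have h5 : Real.log x ^ 2 ≤ κ * √n :=
        calc Real.log x ^ 2 ≤ Real.log x ^ 2 * (Real.log x * κ) :=
              le_mul_of_one_le_right (by positivity) h4
          _ = κ * Real.log x ^ 3 := by ring
          _ ≤ κ * √n := mul_le_mul_of_nonneg_left hsq hκ.le
      calc √n * Real.log x ^ 2 ≤ √n * (κ * √n) :=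
            mul_le_mul_of_nonneg_left h5 (Real.sqrt_nonneg _)
        _ = κ * (√n * √n) := by ring
        _ = κ * n := by rw [Real.mul_self_sqrt (Nat.cast_nonneg _)]
    have h1n : 1 ≤ √(n : ℝ) := by rw [Real.one_le_sqrt]; linarith
    have h5 := hsieve x hx n m hn2 (by omega) hm1 F G hF hG hFne hFG hnlog (h1n.trans hV)
    have h6 : (G.card : ℝ) * √n ^ m ≤ 5 * x :=
      (mul_le_mul_of_nonneg_left (pow_le_pow_left₀ (Real.sqrt_nonneg _) hV m)
        (Nat.cast_nonneg _)).trans h5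
    have h7 := mul_mul_rpow_le hx0 (by linarith) (Nat.cast_nonneg _) hm3 hm2 h6
    have hd : 0 < Real.log x ^ δ := Real.rpow_pos_of_pos hl0 δ
    have h8 : c * (x / Real.log x ^ δ) * x ^ (1 / 16 : ℝ) ≤ 5 * x :=
      (mul_le_mul_of_nonneg_right hprod (by positivity)).trans h7
    have h9 : x * (c * x ^ (1 / 16 : ℝ)) ≤ x * (5 * Real.log x ^ δ) := by
      have h10 := mul_le_mul_of_nonneg_right h8 hd.le
      have h11 : c * (x / Real.log x ^ δ) * x ^ (1 / 16 : ℝ) * Real.log x ^ δ =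
          x * (c * x ^ (1 / 16 : ℝ)) := by field_simp
      linarith
    exact absurd (le_of_mul_le_mul_left h9 hx0) (not_le.2 h1)

end Combination

theorem proposition1 (δ : ℝ) (hδ : 1 ≤ δ) (c : ℝ) (hc : 0 < c) :
    ∃ c₁ : ℝ, 0 < c₁ ∧ ∃ c₂ : ℝ, 0 < c₂ ∧
      ∀ x : ℝ, 2 ≤ x → ∀ F G : Finset ℕ,
        F ⊆ Finset.Icc 1 ⌊x⌋₊ → G ⊆ Finset.Icc 1 ⌊x⌋₊ →
        δ < (F.card : ℝ) → F.card ≤ G.card →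
        (∀ n ∈ F + G, n.Prime ∧ Real.sqrt x < (n : ℝ) ∧ (n : ℝ) < 2 * x) →
        c * (x / Real.log x ^ δ) ≤ (F.card : ℝ) * (G.card : ℝ) →
        c₁ * (Real.sqrt x / Real.log x ^ (δ + 6)) ≤ (F.card : ℝ) ∧
          F.card ≤ G.card ∧
          (G.card : ℝ) ≤ c₂ * (Real.sqrt x * Real.log x ^ 6) := by
  obtain ⟨C, hC, hev⟩ := exists_eventually_card_le_sqrt_mul_log δ (by linarith) c hc
  obtain ⟨X, hX⟩ := Filter.eventually_atTop.1 hev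
  have hl2 : 0 < Real.log 2 := Real.log_pos one_lt_two
  -- for `x ≤ X` the bounds follow from `1 ≤ |F|` and `|G| ≤ x`, since `√x ≤ Y`
  set Y : ℝ := max (√X) 1 with hY
  have hY0 : 0 < Y := lt_of_lt_of_le one_pos (le_max_right _ _)
  refine ⟨min (c / C) (Real.log 2 ^ (δ + 6) / Y), lt_min (by positivity) (by positivity),
    max C (Y / Real.log 2 ^ 6), lt_of_lt_of_le hC (le_max_left _ _), ?_⟩
  intro x hx F G hF hG hFδ hle hsum hprod
  have hx0 : 0 < x := by linarith
  have hs : 0 < √x := Real.sqrt_pos.2 hx0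
  have hlog2 : Real.log 2 ≤ Real.log x := Real.log_le_log two_pos hx
  have hl0 : 0 < Real.log x := by linarith
  have hF1 : (1 : ℝ) ≤ F.card := by linarith
  have hld : 0 < Real.log x ^ (δ + 6) := Real.rpow_pos_of_pos hl0 _
  have hFG : ∀ f ∈ F, ∀ g ∈ G, ∀ p : ℕ, p.Prime → p ^ 2 ≤ ⌊x⌋₊ → ¬ p ∣ g + f := by
    intro f hf g hg p hp hp2 hdvd
    obtain ⟨hprime, hlt, _⟩ := hsum (f + g) (Finset.add_mem_add hf hg)
    rw [add_comm] at hdvd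
    rw [← (Nat.prime_dvd_prime_iff_eq hp hprime).1 hdvd] at hlt
    have h1 : ((p ^ 2 : ℕ) : ℝ) ≤ x := (Nat.le_floor_iff hx0.le).1 hp2
    push_cast at h1
    exact absurd (Real.le_sqrt_of_sq_le h1) (not_le.2 hlt)
  refine ⟨?_, hle, ?_⟩
  · rcases le_total X x with hXx | hxX
    · have hGle := hX x hXx F G hF hG hFδ hFG hprod
      refine (mul_le_mul_of_nonneg_right (min_le_left _ _) (div_pos hs hld).le).trans ?_
      have h1 : c * (x / Real.log x ^ δ) ≤ F.card * (C * (√x * Real.log x ^ 6)) :=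
        hprod.trans (mul_le_mul_of_nonneg_left hGle (Nat.cast_nonneg _))
      have hd : 0 < Real.log x ^ δ := Real.rpow_pos_of_pos hl0 δ
      have h2 : Real.log x ^ (δ + 6) = Real.log x ^ δ * Real.log x ^ 6 := by
        rw [Real.rpow_add hl0, show (6 : ℝ) = ((6 : ℕ) : ℝ) by norm_num, Real.rpow_natCast]
      have h3 : c * (x / Real.log x ^ δ) =
          c / C * (√x / Real.log x ^ (δ + 6)) * (C * (√x * Real.log x ^ 6)) := by
        rw [h2]
        nth_rewrite 1 [← Real.mul_self_sqrt hx0.le]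
        field_simp
      rw [h3] at h1
      exact le_of_mul_le_mul_right h1 (by positivity)
    · refine le_trans ?_ hF1
      refine (mul_le_mul_of_nonneg_right (min_le_right _ _) (div_pos hs hld).le).trans ?_
      have h1 : √x ≤ Y := (Real.sqrt_le_sqrt hxX).trans (le_max_left _ _)
      have h2 : Real.log 2 ^ (δ + 6) ≤ Real.log x ^ (δ + 6) :=
        Real.rpow_le_rpow hl2.le hlog2 (by linarith)
      rw [div_mul_div_comm, div_le_one (by positivity), mul_comm Y]
      exact mul_le_mul h2 h1 hs.le hld.le
  · rcases le_total X x with hXx | hxX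
    · refine (hX x hXx F G hF hG hFδ hFG hprod).trans ?_
      exact mul_le_mul_of_nonneg_right (le_max_left _ _) (by positivity)
    · have hGx : (G.card : ℝ) ≤ x := by
        have h1 := Finset.card_le_card hG
        rw [Nat.card_Icc, Nat.add_sub_cancel] at h1
        exact le_trans (by exact_mod_cast h1) (Nat.floor_le hx0.le)
      have h1 : √x ≤ Y := (Real.sqrt_le_sqrt hxX).trans (le_max_left _ _)
      have h2 : Real.log 2 ^ 6 ≤ Real.log x ^ 6 := pow_le_pow_left₀ hl2.le hlog2 6
      refine hGx.trans (le_trans ?_ (mul_le_mul_of_nonneg_right (le_max_right _ _) (by positivity)))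
      rw [div_mul_eq_mul_div, le_div_iff₀ (by positivity)]
      calc x * Real.log 2 ^ 6 = √x * (√x * Real.log 2 ^ 6) := by
            rw [← mul_assoc, Real.mul_self_sqrt hx0.le]
        _ ≤ Y * (√x * Real.log x ^ 6) := mul_le_mul h1
            (mul_le_mul_of_nonneg_left h2 hs.le) (by positivity) hY0.le
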